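/- **Setting.** Let $f\in C^2(\mathbb R)$ with $f''\ge 0$ and $\mathcal L\{u: f''(u)=0\}=0$, and let $\varphi\in L^\infty(\mathbb R)$. For $t>0$ put $$E(u;x,t)=t\int_0^u f''(s)\big(\varphi(x-tf'(s))-s\big)\,ds,\qquad \mathcal U(x,t)=\{w: E(w;x,t)=\max_{v\in\mathbb R}E(v;x,t)\},\qquad u(x,t)=\inf\,\mathcal U(x,t);$$ $u$ is the entropy solution of $u_t+f(u)_x=0$, $u|_{t=0}=\varphi$. Fix $x_0\in\mathbb R$, and put $$\mathcal C(x_0)=\{c\in\mathbb R:\ c\in\mathcal U(x_0+tf'(c),t)\ \text{for some } t>0\},$$ $$a=\limsup_{y\to x_0-}\frac1{y-x_0}\int_{x_0}^y\varphi,\qquad b=\liminf_{y\to x_0+}\frac1{y-x_0}\int_{x_0}^y\varphi ,$$ $$\Phi(l;x_0,c)=\int_{x_0}^{x_0+l}(\varphi(\xi)-c)\,d\xi,\qquad F(l;t,c)=-t\int_c^{u(l;t,c)}(s-c)f''(s)\,ds,\qquad u(l;t,c)=(f')^{-1}\big(f'(c)-\tfrac lt\big)$$ ($F$ is defined for small $l$).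 For $c\in\mathbb R$ consider the conditions - $(A^\pm_c)$: $f''(u)=(N_\pm+o(1))|u-c|^{\alpha_\pm}$ as $u\to c\pm$, with constants $\alpha_\pm\ge0$, $N_\pm>0$; - $(B^\pm_c)$: $\varphi(x_0+l)-c=(C_\pm+o(1))\,\mathrm{sgn}(l)|l|^{\gamma_\pm}$ for a.e. $l\to0\pm$, with constants $\gamma_\pm>0$, $C_\pm\ne0$; and, under $(A^\mp_c)$, put $\Lambda^\pm_c=\liminf_{l\to0\pm}|l|^{-\frac{2+\alpha_\mp}{1+\alpha_\mp}}\,\Phi(l;x_0,c)\in[-\infty,\infty]$. **Waves.** A *shock emitted from $x_0$* is a continuous curve $x=X(t)$, $0\le t<T$ $(T>0)$, with $X(0)=x_0$ such that for $0<t<T$ the limits $u(X(t)\pm,t)$ exist and $u(X(t)+,t)<u(X(t)-,t)$. Say that the *wave emitted from $x_0$ lies between $p$ and $q$ on $(0,T)$* if $p,q$ are continuous on $[0,T)$, $p(0)=q(0)=x_0$, and for all $0<t<T$: $p(t)\le q(t)$; $x-tf'(u(x,t))<x_0$ for $x<p(t)$; $x-tf'(u(x,t))>x_0$ for $x>q(t)$;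 $u(x,t)=(f')^{-1}\big(\frac{x-x_0}t\big)$ for $p(t)<x<q(t)$; and every shock emitted from $x_0$ coincides with $p$ or with $q$ on the common time interval. An edge ($p$ or $q$) is a *shock* if $u(\cdot,t)$ has one-sided limits on it with right limit smaller than left limit for all $0<t<T$; it is a *characteristic* if for some $c$ it is $x=x_0+tf'(c)$ and, for all $0<t<T$, $u(\cdot,t)$ is continuous on it with value $c$. The *initial wave emitted from $x_0$* is, if this holds for some $T>0$ and some $p,q$: $\mathcal S$ if $p=q$ is a shock; *a characteristic* if $p=q$ is a characteristic; and, with $p<q$ on $(0,T)$: $\mathcal R$ if both edges are characteristics; $\mathcal S+\mathcal R$ if $p$ is a shock and $q$ a characteristic; $\mathcal R+\mathcal S$ if $p$ is a characteristic and $q$ a shock; $\mathcal S+\mathcal R+\mathcal S$ if both edges are shocks. **Theorem.** *I. Criteria for $\mathcal C(x_0)$.* (i) If $a>b$, then $\mathcal C(x_0)=\varnothing$. (ii) If $a<b$, then $(a,b)\subset\mathcal C(x_0)\subset[a,b]$. Moreover: - (a) $a\in\mathcal C(x_0)$ iff there is $t_1>0$ with $\Phi(l;x_0,a)>F(l;t_1,a)$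 for small $l<0$; and $b\in\mathcal C(x_0)$ iff there is $t_2>0$ with $\Phi(l;x_0,b)>F(l;t_2,b)$ for small $l>0$. - (b) If $(A^+_a)$ holds, then $a\in\mathcal C(x_0)$ iff $\Lambda^-_a>-\infty$; if in addition $(B^-_a)$ holds, then $a\in\mathcal C(x_0)$ iff $C_->0$ or $\gamma_-(1+\alpha_+)\ge1$. - (c) If $(A^-_b)$ holds, then $b\in\mathcal C(x_0)$ iff $\Lambda^+_b>-\infty$; if in addition $(B^+_b)$ holds, then $b\in\mathcal C(x_0)$ iff $C_+>0$ or $\gamma_+(1+\alpha_-)\ge1$. (iii) If $a=b$, then $\mathcal C(x_0)=\{a\}$ or $\mathcal C(x_0)=\varnothing$. Moreover: - (a) $a\in\mathcal C(x_0)$ iff there is $t_1>0$ with $\Phi(l;x_0,a)>F(l;t_1,a)$ for small $l\ne0$. - (b) If $(A^+_a)$ and $(A^-_a)$ hold, then $\mathcal C(x_0)=\varnothing$ iff $\Lambda^+_a=-\infty$ or $\Lambda^-_a=-\infty$. - (c) If in addition $(B^+_a)$ and $(B^-_a)$ hold, then $\mathcal C(x_0)=\varnothing$ iff [$C_+<0$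 and $\gamma_+(1+\alpha_-)<1$] or [$C_-<0$ and $\gamma_-(1+\alpha_+)<1$]. *II. Classification.* The initial wave emitted from $x_0$ is of exactly one of the six types, and it is - $\mathcal S$ iff $a>b$, or $a=b$ and $\mathcal C(x_0)=\varnothing$; - a characteristic iff $a=b$ and $\mathcal C(x_0)\ne\varnothing$; - $\mathcal R$ iff $a<b$ and $\mathcal C(x_0)=[a,b]$; - $\mathcal S+\mathcal R$ iff $a<b$ and $\mathcal C(x_0)=(a,b]$; - $\mathcal R+\mathcal S$ iff $a<b$ and $\mathcal C(x_0)=[a,b)$; - $\mathcal S+\mathcal R+\mathcal S$ iff $a<b$ and $\mathcal C(x_0)=(a,b)$. -/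

import Mathlib

open Set Filter Topology MeasureTheory

noncomputable section

namespace ScalarLaw

/-! Scalar conservation law `u_t + f(u)_x = 0`, `u(x,0) = φ(x)`, with `f` a (possibly degenerate)
convex flux and `φ` bounded measurable. Throughout, `deriv f` is `f'` and `deriv (deriv f)` is
`f''`. -/

/-- `E(u; x, t) = t ∫₀ᵘ f''(s) (φ(x - t f'(s)) - s) ds`. -/
def E (f φ : ℝ → ℝ) (u x t : ℝ) : ℝ :=
  t * ∫ s in (0 : ℝ)..u, deriv (deriv f) s * (φ (x - t * deriv f s) - s)

/-- `𝒰(x,t)`: the set of points at which `E(· ; x, t)` attains its maximum over `ℝ`. -/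
def maximizers (f φ : ℝ → ℝ) (x t : ℝ) : Set ℝ :=
  {w | ∀ v, E f φ v x t ≤ E f φ w x t}

/-- The solution formula `u(x,t) = inf 𝒰(x,t)` (used for `t > 0` only), which defines the entropy
solution of the Cauchy problem pointwise. -/
def sol (f φ : ℝ → ℝ) (x t : ℝ) : ℝ := sInf (maximizers f φ x t)

/-- `𝒞(x₀)`: the `c` such that `c ∈ 𝒰(x,t)` for some point `(x,t)`, `t > 0`, of the ray
`x = x₀ + t f'(c)`. -/
def charValues (f φ : ℝ → ℝ) (x₀ : ℝ) : Set ℝ :=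
  {c | ∃ t > 0, c ∈ maximizers f φ (x₀ + t * deriv f c) t}

/-- `Φ(x) = ∫₀ˣ φ`. -/
def primitive (φ : ℝ → ℝ) (x : ℝ) : ℝ := ∫ ξ in (0 : ℝ)..x, φ ξ

/-- Upper left Dini derivative. (For the primitive of an `L^∞` function the difference quotients
are bounded, so the real-valued `limsup` is the genuine one.) -/
def upperLeftDini (g : ℝ → ℝ) (x₀ : ℝ) : ℝ := limsup (slope g x₀) (𝓝[<] x₀)

/-- Lower right Dini derivative. -/
def lowerRightDini (g : ℝ → ℝ) (x₀ : ℝ) : ℝ := liminf (slope g x₀) (𝓝[>] x₀)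

/-- `Φ(l; x₀, c) = ∫_{x₀}^{x₀+l} (φ - c)`. -/
def excess (φ : ℝ → ℝ) (l x₀ c : ℝ) : ℝ := ∫ ξ in x₀..(x₀ + l), (φ ξ - c)

/-- `u(l; t, c) = (f')⁻¹ (f'(c) - l/t)`. The range of the strictly increasing continuous `f'` is
open, so for small `l` this is the genuine inverse. -/
def uOf (f : ℝ → ℝ) (l t c : ℝ) : ℝ := Function.invFun (deriv f) (deriv f c - l / t)

/-- `F(l; t, c) = - t ∫_c^{u(l;t,c)} (s - c) f''(s) ds`. -/
def F (f : ℝ → ℝ) (l t c : ℝ) : ℝ :=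
  -(t * ∫ s in c..uOf f l t c, (s - c) * deriv (deriv f) s)

/-- `f''(u) = (N + o(1)) |u - c|^α` as `u → c` along `L` (`L` is `𝓝[>] c` or `𝓝[<] c`), with
`α ≥ 0` and `N > 0`. -/
def FluxAsymp (f : ℝ → ℝ) (c : ℝ) (L : Filter ℝ) (α N : ℝ) : Prop :=
  0 ≤ α ∧ 0 < N ∧ Tendsto (fun u => deriv (deriv f) u / |u - c| ^ α) L (𝓝 N)

/-- `φ(x₀ + l) - c = (C + o(1)) sgn(l) |l|^γ` for almost every `l → 0` along `L` (`L` is `𝓝[>] 0`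
or `𝓝[<] 0`), with `γ > 0` and `C ≠ 0`. -/
def DataAsymp (φ : ℝ → ℝ) (x₀ c : ℝ) (L : Filter ℝ) (γ C : ℝ) : Prop :=
  0 < γ ∧ C ≠ 0 ∧
    Tendsto (fun l => (φ (x₀ + l) - c) / (Real.sign l * |l| ^ γ)) (L ⊓ ae volume) (𝓝 C)

/-- `liminf_{l → 0} |l|^{-(2+α)/(1+α)} ∫_{x₀}^{x₀+l} (φ - c)` along `L`, in `[-∞, ∞]`. -/
def lowerRate (φ : ℝ → ℝ) (x₀ c : ℝ) (L : Filter ℝ) (α : ℝ) : EReal :=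
  liminf (fun l => ((|l| ^ (-((2 + α) / (1 + α))) * excess φ l x₀ c : ℝ) : EReal)) L

/-- `v` has one-sided limits at `x` with `v(x+) < v(x-)`. -/
def IsDownJump (v : ℝ → ℝ) (x : ℝ) : Prop :=
  ∃ vl vr : ℝ, Tendsto v (𝓝[<] x) (𝓝 vl) ∧ Tendsto v (𝓝[>] x) (𝓝 vr) ∧ vr < vl

/-- The curve `x = X(t)`, `0 < t < T`, is a shock of the solution: `u(X(t)+,t) < u(X(t)-,t)`. -/
def ShockAlong (f φ : ℝ → ℝ) (T : ℝ) (X : ℝ → ℝ) : Prop :=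
  ∀ t ∈ Ioo 0 T, IsDownJump (fun x => sol f φ x t) (X t)

/-- `x = X(t)`, `0 ≤ t < T`, is a shock emitted from `(x₀, 0)`: a continuous curve starting at `x₀`
along which the solution jumps down. -/
def IsShockFrom (f φ : ℝ → ℝ) (x₀ T : ℝ) (X : ℝ → ℝ) : Prop :=
  0 < T ∧ ContinuousOn X (Ico 0 T) ∧ X 0 = x₀ ∧ ShockAlong f φ T X

/-- `x = X(t)`, `0 < t < T`, is a shock-free characteristic segment emitted from `x₀`: for some `c`,
`X(t) = x₀ + t f'(c)`, and `u(·,t)` is continuous at `X(t)` with value `c`. -/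
def CharAlong (f φ : ℝ → ℝ) (x₀ T : ℝ) (X : ℝ → ℝ) : Prop :=
  ∃ c : ℝ, ∀ t ∈ Ioo 0 T, X t = x₀ + t * deriv f c ∧ sol f φ (X t) t = c ∧
    ContinuousAt (fun x => sol f φ x t) (X t)

/-- For `0 < t < T` the wave emitted from `x₀` occupies exactly `p(t) ≤ x ≤ q(t)`, where `p, q` are
continuous and start at `x₀`:
* strictly between `p` and `q` (if `p < q`) the solution is the rarefaction fan
  `u(x,t) = (f')⁻¹((x - x₀)/t)` centred at `x₀`;
* strictly to the left (right) of the wave, the backward characteristic `x - t f'(u(x,t))` starts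
  strictly to the left (right) of `x₀`, so nothing there is emitted from `x₀`;
* there is no shock emitted from `x₀` other than (possibly) the edges `p` and `q`. -/
structure WaveBetween (f φ : ℝ → ℝ) (x₀ T : ℝ) (p q : ℝ → ℝ) : Prop where
  pos : 0 < T
  cont_left : ContinuousOn p (Ico 0 T)
  cont_right : ContinuousOn q (Ico 0 T)
  start_left : p 0 = x₀
  start_right : q 0 = x₀
  le : ∀ t ∈ Ioo 0 T, p t ≤ q t
  left_of : ∀ t ∈ Ioo 0 T, ∀ x < p t, x - t * deriv f (sol f φ x t) < x₀
  right_of : ∀ t ∈ Ioo 0 T, ∀ x > q t, x₀ < x - t * deriv f (sol f φ x t)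
  fan : ∀ t ∈ Ioo 0 T, ∀ x ∈ Ioo (p t) (q t), deriv f (sol f φ x t) = (x - x₀) / t
  shocks : ∀ T' X, IsShockFrom f φ x₀ T' X →
    (∀ t ∈ Ioo 0 (min T T'), X t = p t) ∨ (∀ t ∈ Ioo 0 (min T T'), X t = q t)

/-- The six types of initial waves: `𝒮`, characteristic, `ℛ`, `𝒮+ℛ`, `ℛ+𝒮`, `𝒮+ℛ+𝒮`. -/
inductive WaveType
  | S
  | char
  | R
  | SR
  | RS
  | SRS

/-- The initial wave emitted from `x₀` is of the given type, on some time interval `(0, T)`.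
* `𝒮`: the wave is a single shock curve.
* characteristic: the wave is a single shock-free characteristic.
* `ℛ`, `𝒮+ℛ`, `ℛ+𝒮`, `𝒮+ℛ+𝒮`: the wave is a nondegenerate centred rarefaction fan, each edge of
  which is a shock where `𝒮` stands on that side, and a shock-free characteristic otherwise. -/
def Emits (f φ : ℝ → ℝ) (x₀ : ℝ) : WaveType → Prop
  | .S => ∃ T p, WaveBetween f φ x₀ T p p ∧ ShockAlong f φ T p
  | .char => ∃ T p, WaveBetween f φ x₀ T p p ∧ CharAlong f φ x₀ T p
  | .R => ∃ T p q, WaveBetween f φ x₀ T p q ∧ (∀ t ∈ Ioo 0 T, p t < q t) ∧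
      CharAlong f φ x₀ T p ∧ CharAlong f φ x₀ T q
  | .SR => ∃ T p q, WaveBetween f φ x₀ T p q ∧ (∀ t ∈ Ioo 0 T, p t < q t) ∧
      ShockAlong f φ T p ∧ CharAlong f φ x₀ T q
  | .RS => ∃ T p q, WaveBetween f φ x₀ T p q ∧ (∀ t ∈ Ioo 0 T, p t < q t) ∧
      CharAlong f φ x₀ T p ∧ ShockAlong f φ T q
  | .SRS => ∃ T p q, WaveBetween f φ x₀ T p q ∧ (∀ t ∈ Ioo 0 T, p t < q t) ∧
      ShockAlong f φ T p ∧ ShockAlong f φ T q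

end ScalarLaw

end

open ScalarLaw

/-!
Write `H(v) = v f'(v) - f(v)` for the Legendre transform of `f` at the slope `f'(v)` and `P` for the
primitive of `φ`. The substitution `y = x - t f'(s)` gives (`E_eq`)
`E(u; x, t) = const - (P(x - t f'(u)) + t H(u))`, so that `𝒰(x, t)` is the set of minimizers of a
Hopf–Lax cost. Everything rests on the strict convexity of the Legendre transform, used in the
subgradient form `c (f'(v) - f'(c)) < H(v) - H(c)` for `v ≠ c` (`legendre_lt`), and on
`|P(y) - P(x)| ≤ M |y - x|`, which confines the minimizers to `[-M, M]`.

*The set `𝒞(x₀)`.* That `c` minimizes the cost at `(x₀ + t f'(c), t)` means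
`F(l; t, c) ≤ Φ(l; x₀, c)` for `l = t (f'(c) - f'(v))` and all `v`. Since only `|v| ≤ M` matters and
`F` increases with `t`, shrinking `t` reduces this to a comparison for small `l`
(`mem_charValues_iff`), which splits into independent conditions for `l < 0` and `l > 0`. As
`F ≤ 0` and `F(l) = o(l)`, these conditions determine the position of `c` relative to the Dini
derivatives `a` and `b` up to the endpoints. At an endpoint, an asymptotic `f'' ∼ N |u - c|^α` makes
`-F` comparable to `t^{1-p} |l|^p` with `p = (2 + α)/(1 + α) > 1` (`F_bounds`), and `t^{1-p}` takes
arbitrarily large values, so the condition says that `|l|^{-p} Φ` is bounded below.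

*The wave.* Backward characteristics do not cross (`maximizers_foot_le`), so the foot
`y(x, t) = x - t f'(u(x, t))` is nondecreasing in `x`, and the wave lies between the points
`p(t) ≤ q(t)` where `y` passes from below `x₀` to above `x₀`. A maximizer is the unique one at
earlier times on its characteristic (`maximizers_eq_singleton`); hence characteristics can be
followed back in time, which makes `p` and `q` Lipschitz, and no shock can cross them, which
confines the shocks emitted from `x₀` to the edges (`eq_edge_of_isShockFrom`). The edge `p` is a
characteristic of value `c` when `c` is the least element of `𝒞(x₀)`, and a shock for all times when
`𝒞(x₀)` has no least element (`isDownJump_leftEdge`): the only alternative to a jump is that `p`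
meets at some time a characteristic of value `c ∈ 𝒞(x₀)`, which a smaller value in `𝒞(x₀)`
excludes. Finally the edges of a wave are determined by the solution (`edges_eq`), so its type is
unique.
-/

namespace ScalarLaw

/-! ### The Hopf–Lax form of the solution formula -/

/-- The Legendre transform of `f` at the slope `f'(v)`, as a function of `v`:
`f*(f'(v)) = v f'(v) - f(v)`. -/
noncomputable def legendre (f : ℝ → ℝ) (v : ℝ) : ℝ := v * deriv f v - f v

/-- The Hopf–Lax cost of reaching `(x, t)` along the line of speed `f'(v)`. -/
noncomputable def cost (f φ : ℝ → ℝ) (x t v : ℝ) : ℝ :=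
  primitive φ (x - t * deriv f v) + t * legendre f v

/-- The standing assumptions: `f'` is strictly increasing and `C¹`, and `|φ| ≤ M` almost
everywhere. -/
structure Admissible (f φ : ℝ → ℝ) (M : ℝ) : Prop where
  contDiff : ContDiff ℝ 2 f
  strictMono : StrictMono (deriv f)
  nonneg : 0 ≤ M
  bound : ∀ᵐ x, |φ x| ≤ M
  meas : AEStronglyMeasurable φ volume

/-- The zero set of `f''` is null, so `f'` is constant on no interval. -/
theorem strictMono_deriv {f : ℝ → ℝ} (hf : ContDiff ℝ 2 f)
    (hconv : ∀ u, 0 ≤ deriv (deriv f) u)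
    (hnull : volume {u : ℝ | deriv (deriv f) u = 0} = 0) : StrictMono (deriv f) := by
  have hg : ContDiff ℝ 1 (deriv f) := by
    have := (contDiff_succ_iff_deriv (n := 1)).1 hf
    exact this.2.2
  have hmono : Monotone (deriv f) :=
    monotone_of_deriv_nonneg (hg.differentiable one_ne_zero) hconv
  refine hmono.strictMono_of_injective fun x y hxy => ?_
  by_contra hne
  wlog hlt : x < y generalizing x y
  · exact this y x hxy.symm (Ne.symm hne) (lt_of_le_of_ne (not_lt.1 hlt) (Ne.symm hne))
  have hsub : Ioo x y ⊆ {u : ℝ | deriv (deriv f) u = 0} := by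
    intro u hu
    have : deriv f =ᶠ[𝓝 u] fun _ => deriv f x := by
      filter_upwards [Ioo_mem_nhds hu.1 hu.2] with v hv
      exact le_antisymm (hxy ▸ hmono hv.2.le) (hmono hv.1.le)
    simpa using this.deriv_eq
  have := measure_mono_null hsub hnull
  rw [Real.volume_Ioo, ENNReal.ofReal_eq_zero] at this
  linarith

theorem admissible_of {f φ : ℝ → ℝ} (hf : ContDiff ℝ 2 f)
    (hconv : ∀ u, 0 ≤ deriv (deriv f) u)
    (hnull : volume {u : ℝ | deriv (deriv f) u = 0} = 0)
    (hφ : MemLp φ ⊤ volume) : ∃ M, Admissible f φ M := by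
  refine ⟨(eLpNorm φ ⊤ volume).toReal, hf, strictMono_deriv hf hconv hnull,
    ENNReal.toReal_nonneg, ?_, hφ.1⟩
  have h1 := ae_le_eLpNormEssSup (f := φ) (μ := volume)
  filter_upwards [h1] with x hx
  rw [← eLpNorm_exponent_top] at hx
  have := ENNReal.toReal_mono hφ.2.ne hx
  simpa using this

namespace Admissible

variable {f φ : ℝ → ℝ} {M : ℝ}
theorem contDiff_deriv (h : Admissible f φ M) : ContDiff ℝ 1 (deriv f) :=
  ((contDiff_succ_iff_deriv (n := 1)).1 h.contDiff).2.2

theorem hasDerivAt (h : Admissible f φ M) (u : ℝ) : HasDerivAt f (deriv f u) u :=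
  (h.contDiff.differentiable two_ne_zero u).hasDerivAt

theorem hasDerivAt_deriv (h : Admissible f φ M) (u : ℝ) :
    HasDerivAt (deriv f) (deriv (deriv f) u) u :=
  (h.contDiff_deriv.differentiable one_ne_zero u).hasDerivAt

theorem continuous_deriv (h : Admissible f φ M) : Continuous (deriv f) :=
  h.contDiff_deriv.continuous

theorem continuous_deriv_deriv (h : Admissible f φ M) : Continuous (deriv (deriv f)) :=
  h.contDiff_deriv.continuous_deriv le_rfl

theorem deriv_deriv_nonneg (h : Admissible f φ M) (u : ℝ) : 0 ≤ deriv (deriv f) u :=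
  h.strictMono.monotone.deriv_nonneg

theorem isEmbedding_deriv (h : Admissible f φ M) : IsEmbedding (deriv f) :=
  h.strictMono.isEmbedding_of_ordConnected
    (isPreconnected_range h.continuous_deriv).ordConnected

theorem exists_deriv_eq (h : Admissible f φ M) {u v m : ℝ} (hu : deriv f u ≤ m)
    (hv : m ≤ deriv f v) : ∃ z, deriv f z = m :=
  mem_range_of_exists_le_of_exists_ge h.continuous_deriv ⟨u, hu⟩ ⟨v, hv⟩

theorem hasDerivAt_legendre (h : Admissible f φ M) (u : ℝ) :
    HasDerivAt (legendre f) (u * deriv (deriv f) u) u := by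
  have := ((hasDerivAt_id u).mul (h.hasDerivAt_deriv u)).sub (h.hasDerivAt u)
  refine this.congr_deriv ?_
  simp

theorem continuous_legendre (h : Admissible f φ M) : Continuous (legendre f) :=
  continuous_iff_continuousAt.2 fun u => (h.hasDerivAt_legendre u).continuousAt

/-- Strict convexity of `f*`, in subgradient form: `c` is the slope of `f*` at `f'(c)`. -/
theorem legendre_lt (h : Admissible f φ M) {c v : ℝ} (hne : v ≠ c) :
    c * (deriv f v - deriv f c) < legendre f v - legendre f c := by
  have hc : Continuous f := h.contDiff.continuous
  have hd : Differentiable ℝ f := h.contDiff.differentiable two_ne_zero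
  unfold legendre
  rcases lt_or_gt_of_ne hne with hlt | hlt
  · obtain ⟨ξ, hξ, he⟩ := exists_deriv_eq_slope f hlt hc.continuousOn hd.differentiableOn
    have := h.strictMono hξ.1
    rw [he, lt_div_iff₀ (by linarith)] at this
    linarith
  · obtain ⟨ξ, hξ, he⟩ := exists_deriv_eq_slope f hlt hc.continuousOn hd.differentiableOn
    have := h.strictMono hξ.2
    rw [he, div_lt_iff₀ (by linarith)] at this
    linarith

theorem legendre_le (h : Admissible f φ M) (c v : ℝ) :
    c * (deriv f v - deriv f c) ≤ legendre f v - legendre f c := by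
  rcases eq_or_ne v c with rfl | hne
  · simp
  · exact (h.legendre_lt hne).le

theorem integral_sub_mul_deriv_deriv (h : Admissible f φ M) (c v : ℝ) :
    ∫ s in c..v, (s - c) * deriv (deriv f) s =
      legendre f v - legendre f c - c * (deriv f v - deriv f c) := by
  have hder : ∀ s ∈ uIcc c v, HasDerivAt (fun s => legendre f s - c * deriv f s)
      ((s - c) * deriv (deriv f) s) s := fun s _ =>
    ((h.hasDerivAt_legendre s).sub ((h.hasDerivAt_deriv s).const_mul c)).congr_deriv (by ring)
  rw [intervalIntegral.integral_eq_sub_of_hasDerivAt hder]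
  · ring
  · have := h.continuous_deriv_deriv
    exact Continuous.intervalIntegrable (by fun_prop) _ _

theorem intervalIntegrable (h : Admissible f φ M) (x y : ℝ) :
    IntervalIntegrable φ volume x y := by
  refine (intervalIntegrable_const (c := M)).mono_fun h.meas.restrict ?_
  refine ae_restrict_of_ae ?_
  filter_upwards [h.bound] with z hz
  simpa [abs_of_nonneg h.nonneg] using hz

theorem primitive_sub (h : Admissible f φ M) (x y : ℝ) :
    primitive φ y - primitive φ x = ∫ ξ in x..y, φ ξ :=
  intervalIntegral.integral_interval_sub_left (h.intervalIntegrable 0 y) (h.intervalIntegrable 0 x)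

theorem abs_primitive_sub_le (h : Admissible f φ M) (x y : ℝ) :
    |primitive φ y - primitive φ x| ≤ M * |y - x| := by
  rw [h.primitive_sub]
  rw [← Real.norm_eq_abs]
  refine intervalIntegral.norm_integral_le_of_norm_le_const_ae ?_
  filter_upwards [h.bound] with z hz _ using hz

theorem continuous_primitive (h : Admissible f φ M) : Continuous (primitive φ) := by
  refine (LipschitzWith.of_dist_le_mul (K := ⟨M, h.nonneg⟩) fun x y => ?_).continuous
  rw [Real.dist_eq, Real.dist_eq]
  exact h.abs_primitive_sub_le y x

theorem excess_eq (h : Admissible f φ M) (l x₀ c : ℝ) :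
    excess φ l x₀ c = primitive φ (x₀ + l) - primitive φ x₀ - c * l := by
  rw [excess, intervalIntegral.integral_sub (h.intervalIntegrable _ _) intervalIntegrable_const,
    h.primitive_sub]
  simp [mul_comm]

theorem continuous_cost (h : Admissible f φ M) :
    Continuous fun z : ℝ × ℝ × ℝ => cost f φ z.1 z.2.1 z.2.2 := by
  have h1 := h.continuous_primitive
  have h2 := h.continuous_legendre
  have h3 := h.continuous_deriv
  unfold cost
  fun_prop

/-- Change of variables for `φ` along a backward characteristic; since `f'` is monotone, `φ` need
only be integrable. -/
theorem integral_comp_characteristic (h : Admissible f φ M) {x t : ℝ} (ht : 0 < t) {u v : ℝ}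
    (huv : u ≤ v) :
    IntervalIntegrable (fun s => deriv (deriv f) s * φ (x - t * deriv f s)) volume u v ∧
    t * ∫ s in u..v, deriv (deriv f) s * φ (x - t * deriv f s) =
      primitive φ (x - t * deriv f u) - primitive φ (x - t * deriv f v) := by
  have hder : ∀ s, HasDerivAt (fun s => x - t * deriv f s) (-(t * deriv (deriv f) s)) s := fun s =>
    ((h.hasDerivAt_deriv s).const_mul t).const_sub x
  have hcont : ContinuousOn (fun s => x - t * deriv f s) (Icc u v) :=
    fun s _ => (hder s).continuousAt.continuousWithinAt
  have hneg : ∀ s ∈ Ioo u v, -(t * deriv (deriv f) s) ≤ 0 := fun s _ =>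
    neg_nonpos.2 (mul_nonneg ht.le (h.deriv_deriv_nonneg s))
  have hle : x - t * deriv f v ≤ x - t * deriv f u := by
    have := mul_le_mul_of_nonneg_left (h.strictMono.monotone huv) ht.le
    linarith
  constructor
  · have h1 := (integrableOn_Icc_deriv_smul_iff_of_deriv_nonpos (g := φ) hcont
      (fun s _ => hder s) hneg huv).2
      ((intervalIntegrable_iff_integrableOn_Icc_of_le hle).1 (h.intervalIntegrable _ _))
    rw [intervalIntegrable_iff_integrableOn_Icc_of_le huv]
    refine IntegrableOn.congr_fun (h1.const_mul (-t⁻¹)) (fun s _ => ?_) measurableSet_Icc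
    simp only [smul_eq_mul]
    field_simp
  · have h1 := integral_Icc_deriv_smul_of_deriv_nonpos (g := φ) hcont (fun s _ => hder s) hneg huv
    rw [h.primitive_sub, intervalIntegral.integral_of_le hle, intervalIntegral.integral_of_le huv,
      ← integral_Icc_eq_integral_Ioc, ← integral_Icc_eq_integral_Ioc, ← neg_eq_iff_eq_neg.2 h1,
      ← integral_const_mul, ← integral_neg]
    refine integral_congr_ae (ae_of_all _ fun s => ?_)
    simp only [smul_eq_mul]
    ring

/-- The substitution `y = x - t f'(s)` turns `E` into minus the Hopf–Lax cost. -/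
theorem E_eq (h : Admissible f φ M) {x t : ℝ} (ht : 0 < t) (u : ℝ) :
    E f φ u x t = cost f φ x t 0 - cost f φ x t u := by
  have key : IntervalIntegrable (fun s => deriv (deriv f) s * φ (x - t * deriv f s)) volume 0 u ∧
    t * ∫ s in (0 : ℝ)..u, deriv (deriv f) s * φ (x - t * deriv f s) =
      primitive φ (x - t * deriv f 0) - primitive φ (x - t * deriv f u) := by
    rcases le_total 0 u with hu | hu
    · exact h.integral_comp_characteristic ht hu
    · obtain ⟨h1, h2⟩ := h.integral_comp_characteristic (x := x) ht hu
      refine ⟨h1.symm, ?_⟩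
      rw [intervalIntegral.integral_symm, mul_neg, h2]
      ring
  have h3 := h.integral_sub_mul_deriv_deriv 0 u
  simp only [sub_zero, zero_mul] at h3
  have hI : IntervalIntegrable (fun s => s * deriv (deriv f) s) volume 0 u := by
    have := h.continuous_deriv_deriv
    exact Continuous.intervalIntegrable (by fun_prop) _ _
  have h4 : E f φ u x t = t * ((∫ s in (0 : ℝ)..u, deriv (deriv f) s * φ (x - t * deriv f s)) -
      ∫ s in (0 : ℝ)..u, s * deriv (deriv f) s) := by
    rw [E, ← intervalIntegral.integral_sub key.1 hI]
    congr 2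
    ext s
    ring
  rw [h4, mul_sub, key.2, h3, cost, cost]
  ring

theorem mem_maximizers (h : Admissible f φ M) {x t w : ℝ} (ht : 0 < t) :
    w ∈ maximizers f φ x t ↔ ∀ v, cost f φ x t w ≤ cost f φ x t v := by
  refine forall_congr' fun v => ?_
  rw [h.E_eq ht, h.E_eq ht]
  constructor <;> intro h' <;> linarith

/-- Above `M` the cost exceeds its value at `M`, since `|φ| ≤ M`. -/
theorem cost_lt_of_lt (h : Admissible f φ M) {x t v : ℝ} (ht : 0 < t) (hv : M < v) :
    cost f φ x t M < cost f φ x t v := by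
  have h1 := (abs_le.1 (h.abs_primitive_sub_le (x - t * deriv f M) (x - t * deriv f v))).1
  have h2 := mul_lt_mul_of_pos_left (h.legendre_lt hv.ne') ht
  have h3 := mul_pos ht (sub_pos.2 (h.strictMono hv))
  rw [show x - t * deriv f v - (x - t * deriv f M) = -(t * (deriv f v - deriv f M)) by ring,
    abs_neg, abs_of_pos h3] at h1
  unfold cost
  nlinarith

theorem cost_lt_of_lt_neg (h : Admissible f φ M) {x t v : ℝ} (ht : 0 < t) (hv : v < -M) :
    cost f φ x t (-M) < cost f φ x t v := by
  have h1 := (abs_le.1 (h.abs_primitive_sub_le (x - t * deriv f (-M)) (x - t * deriv f v))).1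
  have h2 := mul_lt_mul_of_pos_left (h.legendre_lt hv.ne) ht
  have h3 := mul_pos ht (sub_pos.2 (h.strictMono hv))
  rw [show x - t * deriv f v - (x - t * deriv f (-M)) = t * (deriv f (-M) - deriv f v) by ring,
    abs_of_pos h3] at h1
  unfold cost
  nlinarith

/-- It suffices to compare costs with the competitors in `[-M, M]`. -/
theorem mem_maximizers_of_Icc (h : Admissible f φ M) {x t w : ℝ} (ht : 0 < t)
    (hw : ∀ v ∈ Icc (-M) M, cost f φ x t w ≤ cost f φ x t v) : w ∈ maximizers f φ x t := by
  have hM := h.nonneg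
  rw [h.mem_maximizers ht]
  intro v
  rcases lt_or_ge M v with hv | hv
  · exact (hw M ⟨by linarith, le_rfl⟩).trans (h.cost_lt_of_lt ht hv).le
  rcases lt_or_ge v (-M) with hv' | hv'
  · exact (hw (-M) ⟨le_rfl, by linarith⟩).trans (h.cost_lt_of_lt_neg ht hv').le
  · exact hw v ⟨hv', hv⟩

theorem maximizers_subset (h : Admissible f φ M) {x t : ℝ} (ht : 0 < t) :
    maximizers f φ x t ⊆ Icc (-M) M := by
  intro w hw
  rw [h.mem_maximizers ht] at hw
  constructor <;> by_contra! hlt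
  · exact (hw _).not_gt (h.cost_lt_of_lt_neg ht hlt)
  · exact (hw _).not_gt (h.cost_lt_of_lt ht hlt)

theorem maximizers_nonempty (h : Admissible f φ M) {x t : ℝ} (ht : 0 < t) :
    (maximizers f φ x t).Nonempty := by
  have hM := h.nonneg
  have hc : Continuous fun v => cost f φ x t v :=
    h.continuous_cost.comp (by fun_prop : Continuous fun v : ℝ => (x, t, v))
  obtain ⟨w, -, hw⟩ := isCompact_Icc.exists_isMinOn (⟨-M, le_rfl, by linarith⟩ :
    (Icc (-M) M).Nonempty) hc.continuousOn
  exact ⟨w, h.mem_maximizers_of_Icc ht fun v hv => hw hv⟩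

/-- The graph of `x ↦ 𝒰(x,t)` is closed. -/
theorem mem_maximizers_of_tendsto (h : Admissible f φ M) {x t w : ℝ} (ht : 0 < t)
    {ι : Type*} {l : Filter ι} [l.NeBot] {y v : ι → ℝ} (hy : Tendsto y l (𝓝 x))
    (hv : Tendsto v l (𝓝 w)) (hm : ∀ᶠ i in l, v i ∈ maximizers f φ (y i) t) :
    w ∈ maximizers f φ x t := by
  rw [h.mem_maximizers ht]
  intro z
  have hc : Continuous fun z : ℝ × ℝ => cost f φ z.1 t z.2 :=
    h.continuous_cost.comp (by fun_prop : Continuous fun z : ℝ × ℝ => (z.1, t, z.2))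
  have h1 := (hc.tendsto (x, w)).comp (hy.prodMk_nhds hv)
  have h2 := (hc.tendsto (x, z)).comp (hy.prodMk_nhds (tendsto_const_nhds (x := z)))
  exact le_of_tendsto_of_tendsto h1 h2 (hm.mono fun i hi => (h.mem_maximizers ht).1 hi z)

theorem isClosed_maximizers (h : Admissible f φ M) {x t : ℝ} (ht : 0 < t) :
    IsClosed (maximizers f φ x t) :=
  isClosed_of_closure_subset fun _ hw => by
    obtain ⟨v, hv, hlim⟩ := mem_closure_iff_seq_limit.1 hw
    exact h.mem_maximizers_of_tendsto ht tendsto_const_nhds hlim (Eventually.of_forall hv)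

theorem sol_mem (h : Admissible f φ M) {x t : ℝ} (ht : 0 < t) :
    sol f φ x t ∈ maximizers f φ x t :=
  (h.isClosed_maximizers ht).csInf_mem (h.maximizers_nonempty ht)
    (bddBelow_Icc.mono (h.maximizers_subset ht))

end Admissible

/-! ### Backward characteristics -/

/-- The point of the initial line from which the backward characteristic of value `sol f φ x t`
through `(x, t)` starts. -/
noncomputable def foot (f φ : ℝ → ℝ) (x t : ℝ) : ℝ := x - t * deriv f (sol f φ x t)

namespace Admissible

variable {f φ : ℝ → ℝ} {M : ℝ}

/-- Backward characteristics do not cross. -/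
theorem maximizers_foot_le (h : Admissible f φ M) {x₁ x₂ t w₁ w₂ : ℝ} (ht : 0 < t)
    (hx : x₁ < x₂) (h₁ : w₁ ∈ maximizers f φ x₁ t) (h₂ : w₂ ∈ maximizers f φ x₂ t) :
    x₁ - t * deriv f w₁ ≤ x₂ - t * deriv f w₂ := by
  by_contra! hlt
  have hgen : ∀ m, t * deriv f w₁ ≤ m → m ≤ t * deriv f w₂ → ∃ z, t * deriv f z = m := by
    intro m hm₁ hm₂
    obtain ⟨z, hz⟩ := h.exists_deriv_eq (u := w₁) (v := w₂) (m := m / t)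
      ((le_div_iff₀ ht).2 (by linarith)) ((div_le_iff₀ ht).2 (by linarith))
    exact ⟨z, by rw [hz]; field_simp⟩
  -- the two swapped lines, from the foot of one characteristic to the endpoint of the other
  obtain ⟨v₁, hv₁⟩ := hgen (x₁ - (x₂ - t * deriv f w₂)) (by linarith) (by linarith)
  obtain ⟨v₂, hv₂⟩ := hgen (x₂ - (x₁ - t * deriv f w₁)) (by linarith) (by linarith)
  have c₁ := (h.mem_maximizers ht).1 h₁ v₁
  have c₂ := (h.mem_maximizers ht).1 h₂ v₂
  unfold cost at c₁ c₂
  rw [hv₁, sub_sub_cancel] at c₁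
  rw [hv₂, sub_sub_cancel] at c₂
  have hsum : legendre f w₁ + legendre f w₂ ≤ legendre f v₁ + legendre f v₂ := by
    by_contra! h'
    have := mul_lt_mul_of_pos_left h' ht
    linarith
  have e₁ : deriv f w₁ < deriv f v₁ := lt_of_mul_lt_mul_left (by linarith) ht.le
  have e₂ : deriv f w₁ < deriv f v₂ := lt_of_mul_lt_mul_left (by linarith) ht.le
  have e₃ : deriv f w₁ + deriv f w₂ = deriv f v₁ + deriv f v₂ :=
    mul_left_cancel₀ ht.ne' (by linarith)
  have hne : ∀ {u v}, deriv f u < deriv f v → u ≠ v := fun h' he => by simp [he] at h'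
  rcases le_total v₁ v₂ with hv | hv
  · have i₁ := h.legendre_lt (hne e₁)
    have i₂ := h.legendre_le v₂ w₂
    rw [show deriv f w₂ - deriv f v₂ = deriv f v₁ - deriv f w₁ by linarith] at i₂
    linarith [mul_nonneg (sub_nonneg.2 hv) (sub_nonneg.2 e₁.le)]
  · have i₁ := h.legendre_lt (hne e₂)
    have i₂ := h.legendre_le v₁ w₂
    rw [show deriv f w₂ - deriv f v₁ = deriv f v₂ - deriv f w₁ by linarith] at i₂
    linarith [mul_nonneg (sub_nonneg.2 hv) (sub_nonneg.2 e₂.le)]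

theorem monotone_foot (h : Admissible f φ M) {t : ℝ} (ht : 0 < t) :
    Monotone fun x => foot f φ x t := by
  intro x y hxy
  rcases hxy.eq_or_lt with rfl | hlt
  · exact le_rfl
  · exact h.maximizers_foot_le ht hlt (h.sol_mem ht) (h.sol_mem ht)

/-- A maximizer is the only one at every earlier point of its characteristic. -/
theorem maximizers_eq_singleton (h : Admissible f φ M) {y s t w : ℝ} (hs : 0 < s) (hst : s < t)
    (hw : w ∈ maximizers f φ (y + t * deriv f w) t) :
    maximizers f φ (y + s * deriv f w) s = {w} := by
  have ht : 0 < t := hs.trans hst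
  have key : ∀ v, v ≠ w → cost f φ (y + s * deriv f w) s w < cost f φ (y + s * deriv f w) s v := by
    intro v hv
    -- the line reaching `(y + t f'(w), t)` from the foot of the competitor `v`
    obtain ⟨z, hz⟩ : ∃ z, t * deriv f z = s * deriv f v + (t - s) * deriv f w := by
      rcases le_total (deriv f v) (deriv f w) with hle | hle
      · obtain ⟨z, hz⟩ := h.exists_deriv_eq (u := v) (v := w)
          (m := (s * deriv f v + (t - s) * deriv f w) / t)
          ((le_div_iff₀ ht).2 (by nlinarith)) ((div_le_iff₀ ht).2 (by nlinarith))
        exact ⟨z, by rw [hz]; field_simp⟩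
      · obtain ⟨z, hz⟩ := h.exists_deriv_eq (u := w) (v := v)
          (m := (s * deriv f v + (t - s) * deriv f w) / t)
          ((le_div_iff₀ ht).2 (by nlinarith)) ((div_le_iff₀ ht).2 (by nlinarith))
        exact ⟨z, by rw [hz]; field_simp⟩
    have hzw : w ≠ z := by
      rintro rfl
      have : s * deriv f w = s * deriv f v := by linarith
      exact hv (h.strictMono.injective (mul_left_cancel₀ hs.ne' this)).symm
    have c := (h.mem_maximizers ht).1 hw z
    unfold cost at c ⊢
    rw [show y + t * deriv f w - t * deriv f z = y + s * deriv f w - s * deriv f v by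
      rw [hz]; ring, add_sub_cancel_right] at c
    rw [add_sub_cancel_right]
    have i₁ := mul_le_mul_of_nonneg_left (h.legendre_le z v) hs.le
    have i₂ := mul_lt_mul_of_pos_left (h.legendre_lt hzw) (sub_pos.2 hst)
    have i₃ : z * (s * deriv f v + (t - s) * deriv f w - t * deriv f z) = 0 := by rw [hz]; ring
    nlinarith
  ext v
  rw [mem_singleton_iff, h.mem_maximizers hs]
  constructor
  · intro hv
    by_contra hne
    exact (hv w).not_gt (key v hne)
  · rintro rfl u
    rcases eq_or_ne u v with rfl | hu
    · exact le_rfl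
    · exact (key u hu).le

theorem sol_eq_of_singleton {x t w : ℝ} (hw : maximizers f φ x t = {w}) : sol f φ x t = w := by
  rw [sol, hw, csInf_singleton]

/-- Along the characteristic through `(x, t)` the solution is constant. -/
theorem sol_transport (h : Admissible f φ M) {x s t : ℝ} (hs : 0 < s) (hst : s < t) :
    maximizers f φ (foot f φ x t + s * deriv f (sol f φ x t)) s = {sol f φ x t} := by
  refine h.maximizers_eq_singleton hs hst ?_
  rw [foot, sub_add_cancel]
  exact h.sol_mem (hs.trans hst)

theorem foot_transport (h : Admissible f φ M) {x s t : ℝ} (hs : 0 < s) (hst : s < t) :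
    foot f φ (foot f φ x t + s * deriv f (sol f φ x t)) s = foot f φ x t := by
  rw [foot, sol_eq_of_singleton (h.sol_transport hs hst), add_sub_cancel_right]

theorem deriv_sol_mem (h : Admissible f φ M) {x t : ℝ} (ht : 0 < t) :
    deriv f (sol f φ x t) ∈ Icc (deriv f (-M)) (deriv f M) := by
  have := h.maximizers_subset ht (h.sol_mem (x := x) ht)
  exact ⟨h.strictMono.monotone this.1, h.strictMono.monotone this.2⟩

/-! ### One-sided limits -/

/-- Along a filter at which the feet converge, the solution converges, to a maximizer. -/
theorem exists_tendsto_sol_of_tendsto_foot (h : Admissible f φ M) {x t y : ℝ} (ht : 0 < t)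
    {L : Filter ℝ} [L.NeBot] (hL : L ≤ 𝓝 x) (hy : Tendsto (fun z => foot f φ z t) L (𝓝 y)) :
    ∃ w ∈ maximizers f φ x t, Tendsto (fun z => sol f φ z t) L (𝓝 w) := by
  have hg : Tendsto (fun z => deriv f (sol f φ z t)) L (𝓝 ((x - y) / t)) := by
    refine (((tendsto_id.mono_left hL).sub hy).div_const t).congr fun z => ?_
    simp only [foot, id]
    field_simp
    ring
  have hm := isClosed_Icc.mem_of_tendsto hg
    (Eventually.of_forall fun z => h.deriv_sol_mem (x := z) ht)
  obtain ⟨w, hw⟩ := h.exists_deriv_eq hm.1 hm.2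
  rw [← hw] at hg
  have hlim : Tendsto (fun z => sol f φ z t) L (𝓝 w) :=
    h.isEmbedding_deriv.isInducing.tendsto_nhds_iff.2 hg
  exact ⟨w, h.mem_maximizers_of_tendsto (y := id) ht hL hlim
    (Eventually.of_forall fun z => h.sol_mem ht), hlim⟩

theorem exists_tendsto_left (h : Admissible f φ M) (x : ℝ) {t : ℝ} (ht : 0 < t) :
    ∃ w ∈ maximizers f φ x t, Tendsto (fun z => sol f φ z t) (𝓝[<] x) (𝓝 w) :=
  h.exists_tendsto_sol_of_tendsto_foot ht nhdsWithin_le_nhds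
    ((h.monotone_foot ht).tendsto_nhdsLT x)

theorem exists_tendsto_right (h : Admissible f φ M) (x : ℝ) {t : ℝ} (ht : 0 < t) :
    ∃ w ∈ maximizers f φ x t, Tendsto (fun z => sol f φ z t) (𝓝[>] x) (𝓝 w) :=
  h.exists_tendsto_sol_of_tendsto_foot ht nhdsWithin_le_nhds
    ((h.monotone_foot ht).tendsto_nhdsGT x)

theorem tendsto_foot (h : Admissible f φ M) {x t w : ℝ} {L : Filter ℝ} (hL : L ≤ 𝓝 x)
    (hw : Tendsto (fun z => sol f φ z t) L (𝓝 w)) :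
    Tendsto (fun z => foot f φ z t) L (𝓝 (x - t * deriv f w)) :=
  (tendsto_id.mono_left hL).sub (((h.continuous_deriv.tendsto w).comp hw).const_mul t)

theorem continuousAt_of_singleton (h : Admissible f φ M) {x t w : ℝ} (ht : 0 < t)
    (hw : maximizers f φ x t = {w}) : ContinuousAt (fun z => sol f φ z t) x := by
  obtain ⟨u, hu, hlu⟩ := h.exists_tendsto_left x ht
  obtain ⟨v, hv, hlv⟩ := h.exists_tendsto_right x ht
  rw [hw, mem_singleton_iff] at hu hv
  subst hu
  subst hv
  rw [continuousAt_iff_continuous_left'_right']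
  unfold ContinuousWithinAt
  simp only [sol_eq_of_singleton hw]
  exact ⟨hlu, hlv⟩

theorem not_continuousAt_of_isDownJump {v : ℝ → ℝ} {x : ℝ} (hj : IsDownJump v x) :
    ¬ContinuousAt v x := by
  obtain ⟨vl, vr, hl, hr, hlt⟩ := hj
  intro hc
  have h1 := tendsto_nhds_unique hl (hc.tendsto.mono_left nhdsWithin_le_nhds)
  have h2 := tendsto_nhds_unique hr (hc.tendsto.mono_left nhdsWithin_le_nhds)
  linarith

/-! ### The region of influence of a point of the initial line -/

theorem mem_charValues {x₀ x t w : ℝ} (ht : 0 < t)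
    (hw : w ∈ maximizers f φ x t) (hx : x - t * deriv f w = x₀) : w ∈ charValues f φ x₀ :=
  ⟨t, ht, by rwa [← hx, sub_add_cancel]⟩

/-- Each `c ∈ 𝒞(x₀)` is the unique maximizer on an initial segment of its characteristic. -/
theorem exists_singleton_of_mem (h : Admissible f φ M) {x₀ c : ℝ} (hc : c ∈ charValues f φ x₀) :
    ∃ T > 0, ∀ t ∈ Ioo 0 T, maximizers f φ (x₀ + t * deriv f c) t = {c} := by
  obtain ⟨T, hT, hm⟩ := hc
  exact ⟨T, hT, fun t ht => h.maximizers_eq_singleton ht.1 ht.2 hm⟩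

end Admissible

/-- Left edge of the set of points whose foot is `x₀`: the supremum of the points
whose foot lies to the left of `x₀`. At `t = 0` it is `x₀`. -/
noncomputable def leftEdge (f φ : ℝ → ℝ) (x₀ t : ℝ) : ℝ := sSup {x | foot f φ x t < x₀}

/-- Right edge of the set of points whose foot is `x₀`: the infimum of the points
whose foot lies to the right of `x₀`. At `t = 0` it is `x₀`. -/
noncomputable def rightEdge (f φ : ℝ → ℝ) (x₀ t : ℝ) : ℝ := sInf {x | x₀ < foot f φ x t}

theorem leftEdge_zero (f φ : ℝ → ℝ) (x₀ : ℝ) : leftEdge f φ x₀ 0 = x₀ := by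
  simp only [leftEdge, foot, zero_mul, sub_zero]
  exact csSup_Iio

theorem rightEdge_zero (f φ : ℝ → ℝ) (x₀ : ℝ) : rightEdge f φ x₀ 0 = x₀ := by
  simp only [rightEdge, foot, zero_mul, sub_zero]
  exact csInf_Ioi

theorem continuousOn_of_slope_bounds {X : ℝ → ℝ} {α β : ℝ}
    (hX : ∀ s t, 0 ≤ s → s < t → X t - X s ∈ Icc ((t - s) * α) ((t - s) * β)) :
    ContinuousOn X (Ici 0) := by
  set K := max |α| |β|
  have hb : ∀ s t, 0 ≤ s → s < t → |X t - X s| ≤ K * |t - s| := by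
    intro s t hs hst
    obtain ⟨h1, h2⟩ := hX s t hs hst
    have hpos := sub_pos.2 hst
    rw [abs_of_pos hpos, abs_le]
    have hα : -K ≤ α := (neg_le_neg (le_max_left _ _)).trans (neg_abs_le α)
    have hβ : β ≤ K := (le_abs_self β).trans (le_max_right _ _)
    constructor <;> nlinarith
  refine (LipschitzOnWith.of_dist_le_mul (K := ⟨K, le_max_of_le_left (abs_nonneg _)⟩)
    fun s hs t ht => ?_).continuousOn
  rw [Real.dist_eq, Real.dist_eq]
  rcases lt_trichotomy s t with hlt | rfl | hlt
  · rw [abs_sub_comm, abs_sub_comm s]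
    exact hb s t hs hlt
  · simp
  · exact hb t s ht hlt

namespace Admissible

variable {f φ : ℝ → ℝ} {M : ℝ}

theorem foot_mem (h : Admissible f φ M) {x t : ℝ} (ht : 0 < t) :
    foot f φ x t ∈ Icc (x - t * deriv f M) (x - t * deriv f (-M)) := by
  obtain ⟨h1, h2⟩ := h.deriv_sol_mem (x := x) ht
  have h3 := mul_le_mul_of_nonneg_left h1 ht.le
  have h4 := mul_le_mul_of_nonneg_left h2 ht.le
  unfold foot
  constructor <;> linarith

theorem bddAbove_foot_lt (h : Admissible f φ M) {x₀ t : ℝ} (ht : 0 < t) :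
    BddAbove {x | foot f φ x t < x₀} :=
  ⟨x₀ + t * deriv f M, fun x hx => by
    have := (h.foot_mem (x := x) ht).1
    rw [mem_ofPred_eq] at hx
    linarith⟩

theorem bddBelow_lt_foot (h : Admissible f φ M) {x₀ t : ℝ} (ht : 0 < t) :
    BddBelow {x | x₀ < foot f φ x t} :=
  ⟨x₀ + t * deriv f (-M), fun x hx => by
    have := (h.foot_mem (x := x) ht).2
    rw [mem_ofPred_eq] at hx
    linarith⟩

theorem foot_lt_of_lt_leftEdge (h : Admissible f φ M) {x₀ x t : ℝ} (ht : 0 < t)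
    (hx : x < leftEdge f φ x₀ t) : foot f φ x t < x₀ := by
  have hne : {x | foot f φ x t < x₀}.Nonempty :=
    ⟨x₀ + t * deriv f (-M) - 1, by
      have := (h.foot_mem (x := x₀ + t * deriv f (-M) - 1) ht).2
      rw [mem_ofPred_eq]
      linarith⟩
  obtain ⟨y, hy, hxy⟩ := exists_lt_of_lt_csSup hne hx
  exact (h.monotone_foot ht hxy.le).trans_lt hy

theorem lt_foot_of_rightEdge_lt (h : Admissible f φ M) {x₀ x t : ℝ} (ht : 0 < t)
    (hx : rightEdge f φ x₀ t < x) : x₀ < foot f φ x t := by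
  have hne : {x | x₀ < foot f φ x t}.Nonempty :=
    ⟨x₀ + t * deriv f M + 1, by
      have := (h.foot_mem (x := x₀ + t * deriv f M + 1) ht).1
      rw [mem_ofPred_eq]
      linarith⟩
  obtain ⟨y, hy, hxy⟩ := exists_lt_of_csInf_lt hne hx
  exact lt_of_lt_of_le hy (h.monotone_foot ht hxy.le)

theorem le_leftEdge (h : Admissible f φ M) {x₀ x t : ℝ} (ht : 0 < t)
    (hx : foot f φ x t < x₀) : x ≤ leftEdge f φ x₀ t :=
  le_csSup (h.bddAbove_foot_lt ht) hx

theorem rightEdge_le (h : Admissible f φ M) {x₀ x t : ℝ} (ht : 0 < t)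
    (hx : x₀ < foot f φ x t) : rightEdge f φ x₀ t ≤ x :=
  csInf_le (h.bddBelow_lt_foot ht) hx

theorem leftEdge_le (h : Admissible f φ M) {x₀ x t : ℝ} (ht : 0 < t)
    (hx : x₀ ≤ foot f φ x t) : leftEdge f φ x₀ t ≤ x :=
  not_lt.1 fun hlt => hx.not_gt (h.foot_lt_of_lt_leftEdge ht hlt)

theorem le_rightEdge (h : Admissible f φ M) {x₀ x t : ℝ} (ht : 0 < t)
    (hx : foot f φ x t ≤ x₀) : x ≤ rightEdge f φ x₀ t :=
  not_lt.1 fun hlt => hx.not_gt (h.lt_foot_of_rightEdge_lt ht hlt)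

theorem leftEdge_le_rightEdge (h : Admissible f φ M) (x₀ : ℝ) {t : ℝ} (ht : 0 < t) :
    leftEdge f φ x₀ t ≤ rightEdge f φ x₀ t :=
  le_of_forall_lt fun _ hx =>
    (exists_between hx).elim fun _ hy =>
      hy.1.trans_le (h.le_rightEdge ht (h.foot_lt_of_lt_leftEdge ht hy.2).le)

theorem foot_eq_of_mem (h : Admissible f φ M) {x₀ x t : ℝ} (ht : 0 < t)
    (hx : x ∈ Ioo (leftEdge f φ x₀ t) (rightEdge f φ x₀ t)) : foot f φ x t = x₀ :=
  le_antisymm (not_lt.1 fun hlt => hx.2.not_ge (h.rightEdge_le ht hlt))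
    (not_lt.1 fun hlt => hx.1.not_ge (h.le_leftEdge ht hlt))

/-- The left edge moves with speeds between `f'(-M)` and `f'(M)`, as characteristics do. -/
theorem leftEdge_sub_mem (h : Admissible f φ M) (x₀ : ℝ) {s t : ℝ} (hs : 0 ≤ s) (hst : s < t) :
    leftEdge f φ x₀ t - leftEdge f φ x₀ s ∈
      Icc ((t - s) * deriv f (-M)) ((t - s) * deriv f M) := by
  have ht := hs.trans_lt hst
  have hpos := sub_pos.2 hst
  rcases hs.eq_or_lt with rfl | hs
  · rw [leftEdge_zero, sub_zero]
    constructor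
    · rw [le_sub_iff_add_le]
      refine le_of_forall_lt fun x hx => ?_
      obtain ⟨y, hy, hy'⟩ := exists_between hx
      refine hy.trans_le (h.le_leftEdge ht ?_)
      have := (h.foot_mem (x := y) ht).2
      linarith
    · rw [sub_le_iff_le_add]
      refine h.leftEdge_le ht ?_
      have := (h.foot_mem (x := t * deriv f M + x₀) ht).1
      linarith
  · have hpt : ∀ x, foot f φ x t + s * deriv f (sol f φ x t) =
        x - (t - s) * deriv f (sol f φ x t) := fun x => by rw [foot]; ring
    constructor
    · rw [le_sub_iff_add_le]
      refine le_of_forall_gt fun x hx => ?_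
      obtain ⟨y, hy, hy'⟩ := exists_between hx
      have h1 : x₀ ≤ foot f φ y t := not_lt.1 fun hlt => hy.not_ge (h.le_leftEdge ht hlt)
      rw [← h.foot_transport hs hst] at h1
      have h2 := h.leftEdge_le hs h1
      rw [hpt] at h2
      have h3 := mul_le_mul_of_nonneg_left (h.deriv_sol_mem (x := y) ht).1 hpos.le
      linarith
    · rw [sub_le_iff_le_add]
      refine le_of_forall_lt fun x hx => ?_
      obtain ⟨y, hy, hy'⟩ := exists_between hx
      have h1 := h.foot_lt_of_lt_leftEdge ht hy'
      rw [← h.foot_transport hs hst] at h1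
      have h2 := h.le_leftEdge hs h1
      rw [hpt] at h2
      have h3 := mul_le_mul_of_nonneg_left (h.deriv_sol_mem (x := y) ht).2 hpos.le
      linarith

theorem rightEdge_sub_mem (h : Admissible f φ M) (x₀ : ℝ) {s t : ℝ} (hs : 0 ≤ s) (hst : s < t) :
    rightEdge f φ x₀ t - rightEdge f φ x₀ s ∈
      Icc ((t - s) * deriv f (-M)) ((t - s) * deriv f M) := by
  have ht := hs.trans_lt hst
  have hpos := sub_pos.2 hst
  rcases hs.eq_or_lt with rfl | hs
  · rw [rightEdge_zero, sub_zero]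
    constructor
    · rw [le_sub_iff_add_le]
      refine h.le_rightEdge ht ?_
      have := (h.foot_mem (x := t * deriv f (-M) + x₀) ht).2
      linarith
    · rw [sub_le_iff_le_add]
      refine le_of_forall_gt fun x hx => ?_
      obtain ⟨y, hy, hy'⟩ := exists_between hx
      refine (h.rightEdge_le ht ?_).trans_lt hy'
      have := (h.foot_mem (x := y) ht).1
      linarith
  · have hpt : ∀ x, foot f φ x t + s * deriv f (sol f φ x t) =
        x - (t - s) * deriv f (sol f φ x t) := fun x => by rw [foot]; ring
    constructor
    · rw [le_sub_iff_add_le]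
      refine le_of_forall_gt fun x hx => ?_
      obtain ⟨y, hy, hy'⟩ := exists_between hx
      have h1 := h.lt_foot_of_rightEdge_lt ht hy
      rw [← h.foot_transport hs hst] at h1
      have h2 := h.rightEdge_le hs h1
      rw [hpt] at h2
      have h3 := mul_le_mul_of_nonneg_left (h.deriv_sol_mem (x := y) ht).1 hpos.le
      linarith
    · rw [sub_le_iff_le_add]
      refine le_of_forall_lt fun x hx => ?_
      obtain ⟨y, hy, hy'⟩ := exists_between hx
      have h1 : foot f φ y t ≤ x₀ := not_lt.1 fun hlt => hy'.not_ge (h.rightEdge_le ht hlt)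
      rw [← h.foot_transport hs hst] at h1
      have h2 := h.le_rightEdge hs h1
      rw [hpt] at h2
      have h3 := mul_le_mul_of_nonneg_left (h.deriv_sol_mem (x := y) ht).2 hpos.le
      linarith

theorem continuousOn_leftEdge (h : Admissible f φ M) (x₀ : ℝ) :
    ContinuousOn (leftEdge f φ x₀) (Ici 0) :=
  continuousOn_of_slope_bounds fun _ _ => h.leftEdge_sub_mem x₀

theorem continuousOn_rightEdge (h : Admissible f φ M) (x₀ : ℝ) :
    ContinuousOn (rightEdge f φ x₀) (Ici 0) :=
  continuousOn_of_slope_bounds fun _ _ => h.rightEdge_sub_mem x₀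

/-! ### The wave between the two edges -/

theorem not_singleton_of_isDownJump (h : Admissible f φ M) {x t w : ℝ} (ht : 0 < t)
    (hj : IsDownJump (fun z => sol f φ z t) x) : maximizers f φ x t ≠ {w} :=
  fun hw => not_continuousAt_of_isDownJump hj (h.continuousAt_of_singleton ht hw)

theorem deriv_sol_of_mem (h : Admissible f φ M) {x₀ x t : ℝ} (ht : 0 < t)
    (hx : x ∈ Ioo (leftEdge f φ x₀ t) (rightEdge f φ x₀ t)) :
    deriv f (sol f φ x t) = (x - x₀) / t := by
  have := h.foot_eq_of_mem ht hx
  rw [eq_div_iff ht.ne', ← this, foot]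
  ring

theorem not_isDownJump_of_mem (h : Admissible f φ M) {x₀ x t : ℝ} (ht : 0 < t)
    (hx : x ∈ Ioo (leftEdge f φ x₀ t) (rightEdge f φ x₀ t)) :
    ¬IsDownJump (fun z => sol f φ z t) x := by
  rintro ⟨vl, vr, hl, hr, hlt⟩
  have hfoot : ∀ᶠ z in 𝓝 x, foot f φ z t = x₀ := by
    filter_upwards [Ioo_mem_nhds hx.1 hx.2] with z hz using h.foot_eq_of_mem ht hz
  have key : ∀ {L : Filter ℝ} [L.NeBot] {v : ℝ}, L ≤ 𝓝 x →
      Tendsto (fun z => sol f φ z t) L (𝓝 v) → x - t * deriv f v = x₀ := fun hL hv =>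
    tendsto_nhds_unique (h.tendsto_foot hL hv)
      (tendsto_const_nhds.congr' ((hfoot.filter_mono hL).mono fun _ hz => hz.symm))
  have e₁ := key nhdsWithin_le_nhds hl
  have e₂ := key nhdsWithin_le_nhds hr
  exact (mul_lt_mul_of_pos_left (h.strictMono hlt) ht).ne (by linarith)

/-- A shock that starts on one side of a characteristic cannot be on its other side at a later
time `t`: it would cross it, and the solution has no jump on a characteristic before time `t`. -/
theorem not_isShockFrom_of_crossing (h : Admissible f φ M) {x₀ T t x : ℝ} {X : ℝ → ℝ}
    (hX : IsShockFrom f φ x₀ T X) (ht : t ∈ Ioo 0 T)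
    (hcross : (X t < x ∧ foot f φ x t < x₀) ∨ (x < X t ∧ x₀ < foot f φ x t)) : False := by
  obtain ⟨hT, hc, h0, hj⟩ := hX
  set w := sol f φ x t
  have hd : ContinuousOn (fun s => X s - (foot f φ x t + s * deriv f w)) (Icc 0 t) :=
    (hc.mono fun s hs => ⟨hs.1, hs.2.trans_lt ht.2⟩).sub (by fun_prop)
  have e0 : X 0 - (foot f φ x t + 0 * deriv f w) = x₀ - foot f φ x t := by rw [h0]; ring
  have et : X t - (foot f φ x t + t * deriv f w) = X t - x := by simp only [foot, w]; ring
  obtain ⟨s, hs, hs0⟩ : ∃ s ∈ Ioo 0 t, X s - (foot f φ x t + s * deriv f w) = 0 := by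
    rcases hcross with ⟨h1, h2⟩ | ⟨h1, h2⟩
    · exact intermediate_value_Ioo' ht.1.le hd
        (by simp only [e0, et]; constructor <;> linarith)
    · exact intermediate_value_Ioo ht.1.le hd
        (by simp only [e0, et]; constructor <;> linarith)
  have hsing := h.sol_transport (x := x) hs.1 hs.2
  rw [← sub_eq_zero.1 hs0] at hsing
  exact h.not_singleton_of_isDownJump hs.1 (hj s ⟨hs.1, hs.2.trans ht.2⟩) hsing

/-- Every shock emitted from `x₀` runs along one of the two edges. -/
theorem eq_edge_of_isShockFrom (h : Admissible f φ M) {x₀ T t : ℝ} {X : ℝ → ℝ}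
    (hX : IsShockFrom f φ x₀ T X) (ht : t ∈ Ioo 0 T) :
    X t = leftEdge f φ x₀ t ∨ X t = rightEdge f φ x₀ t := by
  rcases lt_trichotomy (X t) (leftEdge f φ x₀ t) with hlt | heq | hlt
  · obtain ⟨x, hx, hx'⟩ := exists_between hlt
    exact (h.not_isShockFrom_of_crossing hX ht
      (Or.inl ⟨hx, h.foot_lt_of_lt_leftEdge ht.1 hx'⟩)).elim
  · exact Or.inl heq
  rcases lt_trichotomy (X t) (rightEdge f φ x₀ t) with hlt' | heq | hlt'
  · exact (h.not_isDownJump_of_mem ht.1 ⟨hlt, hlt'⟩ (hX.2.2.2 t ht)).elim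
  · exact Or.inr heq
  · obtain ⟨x, hx, hx'⟩ := exists_between hlt'
    exact (h.not_isShockFrom_of_crossing hX ht
      (Or.inr ⟨hx', h.lt_foot_of_rightEdge_lt ht.1 hx⟩)).elim

theorem waveBetween (h : Admissible f φ M) {x₀ T : ℝ} (hT : 0 < T)
    (hor : (∀ t ∈ Ioo 0 T, leftEdge f φ x₀ t = rightEdge f φ x₀ t) ∨
      ∀ t ∈ Ioo 0 T, leftEdge f φ x₀ t < rightEdge f φ x₀ t) :
    WaveBetween f φ x₀ T (leftEdge f φ x₀) (rightEdge f φ x₀) where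
  pos := hT
  cont_left := (h.continuousOn_leftEdge x₀).mono fun _ ht => ht.1
  cont_right := (h.continuousOn_rightEdge x₀).mono fun _ ht => ht.1
  start_left := leftEdge_zero f φ x₀
  start_right := rightEdge_zero f φ x₀
  le := fun _ ht => h.leftEdge_le_rightEdge x₀ ht.1
  left_of := fun _ ht _ hx => h.foot_lt_of_lt_leftEdge ht.1 hx
  right_of := fun _ ht _ hx => h.lt_foot_of_rightEdge_lt ht.1 hx
  fan := fun _ ht _ hx => h.deriv_sol_of_mem ht.1 hx
  shocks := by
    intro T' X hX
    have hsub : ∀ t ∈ Ioo 0 (min T T'), t ∈ Ioo 0 T ∧ t ∈ Ioo 0 T' := fun t ht =>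
      ⟨⟨ht.1, ht.2.trans_le (min_le_left _ _)⟩, ⟨ht.1, ht.2.trans_le (min_le_right _ _)⟩⟩
    rcases hor with heq | hlt
    · refine Or.inl fun t ht => ?_
      rcases h.eq_edge_of_isShockFrom hX (hsub t ht).2 with he | he
      · exact he
      · rw [he, heq t (hsub t ht).1]
    · have hsubset : Ioo 0 (min T T') ⊆ Ici 0 := fun t ht => ht.1.le
      have hXc : ContinuousOn X (Ioo 0 (min T T')) :=
        hX.2.1.mono fun t ht => ⟨ht.1.le, (hsub t ht).2.2⟩
      by_contra! hne
      obtain ⟨⟨t₁, ht₁, hne₁⟩, t₂, ht₂, hne₂⟩ := hne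
      have h₁ := (h.eq_edge_of_isShockFrom hX (hsub t₁ ht₁).2).resolve_left hne₁
      have h₂ := (h.eq_edge_of_isShockFrom hX (hsub t₂ ht₂).2).resolve_right hne₂
      -- the gap to the midpoint of the fan changes sign, so it vanishes somewhere
      have hgc : ContinuousOn (fun t => 2 * X t - leftEdge f φ x₀ t - rightEdge f φ x₀ t)
          (Ioo 0 (min T T')) :=
        ((hXc.const_mul 2).sub ((h.continuousOn_leftEdge x₀).mono hsubset)).sub
          ((h.continuousOn_rightEdge x₀).mono hsubset)
      obtain ⟨t, ht, h0⟩ := isPreconnected_Ioo.intermediate_value ht₂ ht₁ hgc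
        (show (0 : ℝ) ∈ _ from ⟨by
          have := hlt t₂ (hsub t₂ ht₂).1
          rw [h₂]; linarith, by
          have := hlt t₁ (hsub t₁ ht₁).1
          rw [h₁]; linarith⟩)
      have := hlt t (hsub t ht).1
      dsimp only at h0
      rcases h.eq_edge_of_isShockFrom hX (hsub t ht).2 with he | he <;> rw [he] at h0 <;> linarith

theorem waveBetween_self (h : Admissible f φ M) {x₀ T : ℝ} (hT : 0 < T)
    (heq : ∀ t ∈ Ioo 0 T, leftEdge f φ x₀ t = rightEdge f φ x₀ t) :
    WaveBetween f φ x₀ T (leftEdge f φ x₀) (leftEdge f φ x₀) where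
  pos := hT
  cont_left := (h.continuousOn_leftEdge x₀).mono fun _ ht => ht.1
  cont_right := (h.continuousOn_leftEdge x₀).mono fun _ ht => ht.1
  start_left := leftEdge_zero f φ x₀
  start_right := leftEdge_zero f φ x₀
  le := fun _ _ => le_rfl
  left_of := fun _ ht _ hx => h.foot_lt_of_lt_leftEdge ht.1 hx
  right_of := fun t ht _ hx => h.lt_foot_of_rightEdge_lt ht.1 (heq t ht ▸ hx)
  fan := fun _ _ _ hx => (hx.1.trans hx.2).false.elim
  shocks := fun T' X hX => by
    refine ((h.waveBetween hT (Or.inl heq)).shocks T' X hX).imp id fun h' t ht => ?_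
    rw [h' t ht, heq t ⟨ht.1, ht.2.trans_le (min_le_left _ _)⟩]

/-- The edges of a wave are determined by the solution. -/
theorem edges_eq (h : Admissible f φ M) {x₀ T : ℝ} {p q : ℝ → ℝ} (hw : WaveBetween f φ x₀ T p q)
    {t : ℝ} (ht : t ∈ Ioo 0 T) : p t = leftEdge f φ x₀ t ∧ q t = rightEdge f φ x₀ t := by
  have hge : ∀ x, p t < x → x < q t → foot f φ x t = x₀ := fun x h1 h2 => by
    rw [foot, hw.fan t ht x ⟨h1, h2⟩, mul_div_cancel₀ _ ht.1.ne']
    ring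
  have hpq := hw.le t ht
  constructor
  · refine le_antisymm (le_of_forall_lt fun x hx => ?_) (le_of_forall_gt fun x hx => ?_)
    · obtain ⟨y, hy, hy'⟩ := exists_between hx
      exact hy.trans_le (h.le_leftEdge ht.1 (hw.left_of t ht y hy'))
    · obtain ⟨y, hy, hy'⟩ := exists_between hx
      refine (h.leftEdge_le ht.1 ?_).trans_lt hy'
      rcases hpq.lt_or_eq with hlt | heq
      · obtain ⟨z, hz, hz'⟩ := exists_between (lt_min hy hlt)
        exact (hge z hz (hz'.trans_le (min_le_right _ _))).ge.trans
          (h.monotone_foot ht.1 (hz'.le.trans (min_le_left _ _)))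
      · exact (hw.right_of t ht y (heq ▸ hy)).le
  · refine le_antisymm (le_of_forall_lt fun x hx => ?_) (le_of_forall_gt fun x hx => ?_)
    · obtain ⟨y, hy, hy'⟩ := exists_between hx
      refine hy.trans_le (h.le_rightEdge ht.1 ?_)
      rcases hpq.lt_or_eq with hlt | heq
      · obtain ⟨z, hz, hz'⟩ := exists_between (max_lt hy' hlt)
        exact (h.monotone_foot ht.1 ((le_max_left _ _).trans hz.le)).trans
          (hge z ((le_max_right _ _).trans_lt hz) hz').le
      · exact (hw.left_of t ht y (heq ▸ hy')).le
    · obtain ⟨y, hy, hy'⟩ := exists_between hx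
      exact (h.rightEdge_le ht.1 (hw.right_of t ht y hy)).trans_lt hy'

/-! ### The edges as shocks or characteristics -/

/-- The characteristics emitted from `x₀` lie between the edges. -/
theorem edges_of_mem (h : Admissible f φ M) {x₀ t c : ℝ} (ht : 0 < t)
    (hc : maximizers f φ (x₀ + t * deriv f c) t = {c}) :
    leftEdge f φ x₀ t ≤ x₀ + t * deriv f c ∧ x₀ + t * deriv f c ≤ rightEdge f φ x₀ t := by
  have hfoot : foot f φ (x₀ + t * deriv f c) t = x₀ := by
    rw [foot, sol_eq_of_singleton hc, add_sub_cancel_right]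
  exact ⟨h.leftEdge_le ht hfoot.ge, h.le_rightEdge ht hfoot.le⟩

theorem sol_mem_charValues (h : Admissible f φ M) {x₀ x t : ℝ} (ht : 0 < t)
    (hx : foot f φ x t = x₀) : sol f φ x t ∈ charValues f φ x₀ :=
  mem_charValues ht (h.sol_mem ht) hx

theorem leftEdge_eq_of_isLeast (h : Admissible f φ M) {x₀ t c : ℝ} (ht : 0 < t)
    (hc : maximizers f φ (x₀ + t * deriv f c) t = {c}) (hmin : ∀ d ∈ charValues f φ x₀, c ≤ d) :
    leftEdge f φ x₀ t = x₀ + t * deriv f c := by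
  obtain ⟨h1, h2⟩ := h.edges_of_mem ht hc
  by_contra hne
  obtain ⟨x, hx, hx'⟩ := exists_between (lt_of_le_of_ne h1 hne)
  have hfoot := h.foot_eq_of_mem ht ⟨hx, hx'.trans_le h2⟩
  have h3 := mul_le_mul_of_nonneg_left
    (h.strictMono.monotone (hmin _ (h.sol_mem_charValues ht hfoot))) ht.le
  rw [foot] at hfoot
  linarith

theorem rightEdge_eq_of_isGreatest (h : Admissible f φ M) {x₀ t c : ℝ} (ht : 0 < t)
    (hc : maximizers f φ (x₀ + t * deriv f c) t = {c}) (hmax : ∀ d ∈ charValues f φ x₀, d ≤ c) :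
    rightEdge f φ x₀ t = x₀ + t * deriv f c := by
  obtain ⟨h1, h2⟩ := h.edges_of_mem ht hc
  by_contra hne
  obtain ⟨x, hx, hx'⟩ := exists_between (lt_of_le_of_ne h2 (Ne.symm hne))
  have hfoot := h.foot_eq_of_mem ht ⟨h1.trans_lt hx, hx'⟩
  have h3 := mul_le_mul_of_nonneg_left
    (h.strictMono.monotone (hmax _ (h.sol_mem_charValues ht hfoot))) ht.le
  rw [foot] at hfoot
  linarith

theorem charAlong_of_forall (h : Admissible f φ M) {x₀ T c : ℝ} {X : ℝ → ℝ}
    (hc : ∀ t ∈ Ioo 0 T, maximizers f φ (x₀ + t * deriv f c) t = {c})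
    (hX : ∀ t ∈ Ioo 0 T, X t = x₀ + t * deriv f c) : CharAlong f φ x₀ T X :=
  ⟨c, fun t ht => ⟨hX t ht, by rw [hX t ht, sol_eq_of_singleton (hc t ht)], by
    rw [hX t ht]; exact h.continuousAt_of_singleton ht.1 (hc t ht)⟩⟩

theorem exists_charAlong_leftEdge (h : Admissible f φ M) {x₀ c : ℝ}
    (hc : IsLeast (charValues f φ x₀) c) :
    ∃ T > 0, ∀ T' ≤ T, CharAlong f φ x₀ T' (leftEdge f φ x₀) := by
  obtain ⟨T, hT, hs⟩ := h.exists_singleton_of_mem hc.1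
  refine ⟨T, hT, fun T' hT' => ?_⟩
  have hs' : ∀ t ∈ Ioo 0 T', maximizers f φ (x₀ + t * deriv f c) t = {c} :=
    fun t ht => hs t ⟨ht.1, ht.2.trans_le hT'⟩
  exact h.charAlong_of_forall hs' fun t ht => h.leftEdge_eq_of_isLeast ht.1 (hs' t ht) hc.2

theorem exists_charAlong_rightEdge (h : Admissible f φ M) {x₀ c : ℝ}
    (hc : IsGreatest (charValues f φ x₀) c) :
    ∃ T > 0, ∀ T' ≤ T, CharAlong f φ x₀ T' (rightEdge f φ x₀) := by
  obtain ⟨T, hT, hs⟩ := h.exists_singleton_of_mem hc.1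
  refine ⟨T, hT, fun T' hT' => ?_⟩
  have hs' : ∀ t ∈ Ioo 0 T', maximizers f φ (x₀ + t * deriv f c) t = {c} :=
    fun t ht => hs t ⟨ht.1, ht.2.trans_le hT'⟩
  exact h.charAlong_of_forall hs' fun t ht => h.rightEdge_eq_of_isGreatest ht.1 (hs' t ht) hc.2

/-- If `𝒞(x₀)` has no least element, the left edge is a shock for all times. -/
theorem isDownJump_leftEdge (h : Admissible f φ M) {x₀ t : ℝ} (ht : 0 < t)
    (hC : ∀ c ∈ charValues f φ x₀, ∃ d ∈ charValues f φ x₀, d < c) :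
    IsDownJump (fun x => sol f φ x t) (leftEdge f φ x₀ t) := by
  set p := leftEdge f φ x₀ t
  obtain ⟨vl, hvl, hl⟩ := h.exists_tendsto_left p ht
  obtain ⟨vr, hvr, hr⟩ := h.exists_tendsto_right p ht
  have hleft : p - t * deriv f vl ≤ x₀ :=
    le_of_tendsto (h.tendsto_foot nhdsWithin_le_nhds hl) <| by
      filter_upwards [self_mem_nhdsWithin] with z hz using (h.foot_lt_of_lt_leftEdge ht hz).le
  have hright : x₀ ≤ p - t * deriv f vr :=
    ge_of_tendsto (h.tendsto_foot nhdsWithin_le_nhds hr) <| by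
      filter_upwards [self_mem_nhdsWithin] with z hz
      exact not_lt.1 fun hlt => (h.le_leftEdge ht hlt).not_gt hz
  have hle : vr ≤ vl := h.strictMono.le_iff_le.1 (le_of_mul_le_mul_left (by linarith) ht)
  refine ⟨vl, vr, hl, hr, lt_of_le_of_ne hle ?_⟩
  rintro rfl
  have hp : p - t * deriv f vr = x₀ := le_antisymm hleft hright
  -- the characteristic of value `vr` ends on the left edge at time `t`; a smaller value
  -- `d` of `𝒞(x₀)` puts the edge strictly to its left at early times `s`
  obtain ⟨d, hd, hdc⟩ := hC vr (mem_charValues ht hvr hp)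
  obtain ⟨T, hT, hs⟩ := h.exists_singleton_of_mem hd
  obtain ⟨s, hs0, hs1⟩ := exists_between (lt_min hT ht)
  have hsT := hs1.trans_le (min_le_left _ _)
  have hst := hs1.trans_le (min_le_right _ _)
  have h1 := (h.edges_of_mem hs0 (hs s ⟨hs0, hsT⟩)).1
  -- while the characteristics arriving from the left of the edge converge to it
  have hlim : Tendsto (fun z => foot f φ z t + s * deriv f (sol f φ z t)) (𝓝[<] p)
      (𝓝 (p - t * deriv f vr + s * deriv f vr)) :=
    (h.tendsto_foot nhdsWithin_le_nhds hl).add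
      (((h.continuous_deriv.tendsto _).comp hl).const_mul s)
  have h2 : p - t * deriv f vr + s * deriv f vr ≤ leftEdge f φ x₀ s :=
    le_of_tendsto hlim <| by
      filter_upwards [self_mem_nhdsWithin] with z hz
      refine h.le_leftEdge hs0 ?_
      rw [h.foot_transport hs0 hst]
      exact h.foot_lt_of_lt_leftEdge ht hz
  rw [hp] at h2
  have h3 := mul_lt_mul_of_pos_left (h.strictMono hdc) hs0
  linarith

/-- If `𝒞(x₀)` has no greatest element, the right edge is a shock for all times. -/
theorem isDownJump_rightEdge (h : Admissible f φ M) {x₀ t : ℝ} (ht : 0 < t)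
    (hC : ∀ c ∈ charValues f φ x₀, ∃ d ∈ charValues f φ x₀, c < d) :
    IsDownJump (fun x => sol f φ x t) (rightEdge f φ x₀ t) := by
  set q := rightEdge f φ x₀ t
  obtain ⟨vl, hvl, hl⟩ := h.exists_tendsto_left q ht
  obtain ⟨vr, hvr, hr⟩ := h.exists_tendsto_right q ht
  have hleft : q - t * deriv f vl ≤ x₀ :=
    le_of_tendsto (h.tendsto_foot nhdsWithin_le_nhds hl) <| by
      filter_upwards [self_mem_nhdsWithin] with z hz
      exact not_lt.1 fun hlt => (h.rightEdge_le ht hlt).not_gt hz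
  have hright : x₀ ≤ q - t * deriv f vr :=
    ge_of_tendsto (h.tendsto_foot nhdsWithin_le_nhds hr) <| by
      filter_upwards [self_mem_nhdsWithin] with z hz using (h.lt_foot_of_rightEdge_lt ht hz).le
  have hle : vr ≤ vl := h.strictMono.le_iff_le.1 (le_of_mul_le_mul_left (by linarith) ht)
  refine ⟨vl, vr, hl, hr, lt_of_le_of_ne hle ?_⟩
  rintro rfl
  have hq : q - t * deriv f vr = x₀ := le_antisymm hleft hright
  obtain ⟨d, hd, hdc⟩ := hC vr (mem_charValues ht hvr hq)
  obtain ⟨T, hT, hs⟩ := h.exists_singleton_of_mem hd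
  obtain ⟨s, hs0, hs1⟩ := exists_between (lt_min hT ht)
  have hsT := hs1.trans_le (min_le_left _ _)
  have hst := hs1.trans_le (min_le_right _ _)
  have h1 := (h.edges_of_mem hs0 (hs s ⟨hs0, hsT⟩)).2
  have hlim : Tendsto (fun z => foot f φ z t + s * deriv f (sol f φ z t)) (𝓝[>] q)
      (𝓝 (q - t * deriv f vr + s * deriv f vr)) :=
    (h.tendsto_foot nhdsWithin_le_nhds hr).add
      (((h.continuous_deriv.tendsto _).comp hr).const_mul s)
  have h2 : rightEdge f φ x₀ s ≤ q - t * deriv f vr + s * deriv f vr :=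
    ge_of_tendsto hlim <| by
      filter_upwards [self_mem_nhdsWithin] with z hz
      refine h.rightEdge_le hs0 ?_
      rw [h.foot_transport hs0 hst]
      exact h.lt_foot_of_rightEdge_lt ht hz
  rw [hq] at h2
  have h3 := mul_lt_mul_of_pos_left (h.strictMono hdc) hs0
  linarith

theorem leftEdge_eq_rightEdge_of_subsingleton (h : Admissible f φ M) {x₀ t : ℝ} (ht : 0 < t)
    (hC : (charValues f φ x₀).Subsingleton) : leftEdge f φ x₀ t = rightEdge f φ x₀ t := by
  by_contra hne
  have hlt := lt_of_le_of_ne (h.leftEdge_le_rightEdge x₀ ht) hne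
  obtain ⟨y, hy, hy'⟩ := exists_between hlt
  obtain ⟨x, hx, hx'⟩ := exists_between hy
  have e₁ := h.foot_eq_of_mem ht ⟨hy, hy'⟩
  have e₂ := h.foot_eq_of_mem ht ⟨hx, hx'.trans hy'⟩
  have e₃ := hC (h.sol_mem_charValues ht e₁) (h.sol_mem_charValues ht e₂)
  rw [foot] at e₁ e₂
  rw [e₃] at e₁
  linarith

theorem exists_leftEdge_lt_rightEdge (h : Admissible f φ M) {x₀ c d : ℝ}
    (hc : c ∈ charValues f φ x₀) (hd : d ∈ charValues f φ x₀) (hcd : c < d) :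
    ∃ T > 0, ∀ t ∈ Ioo 0 T, leftEdge f φ x₀ t < rightEdge f φ x₀ t := by
  obtain ⟨T₁, hT₁, hs₁⟩ := h.exists_singleton_of_mem hc
  obtain ⟨T₂, hT₂, hs₂⟩ := h.exists_singleton_of_mem hd
  refine ⟨min T₁ T₂, lt_min hT₁ hT₂, fun t ht => ?_⟩
  have h1 := (h.edges_of_mem ht.1 (hs₁ t ⟨ht.1, ht.2.trans_le (min_le_left _ _)⟩)).1
  have h2 := (h.edges_of_mem ht.1 (hs₂ t ⟨ht.1, ht.2.trans_le (min_le_right _ _)⟩)).2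
  have h3 := mul_lt_mul_of_pos_left (h.strictMono hcd) ht.1
  linarith

/-! ### Uniqueness of the type of a wave -/

theorem eq_of_emits (h : Admissible f φ M) {x₀ : ℝ} {w w' : WaveType} (hw : Emits f φ x₀ w)
    (hw' : Emits f φ x₀ w') : w = w' := by
  -- the type is read off at a single small time: whether the edges coincide, and whether the
  -- solution jumps or is continuous on each of them
  let P (w : WaveType) (t : ℝ) : Prop :=
    let p := leftEdge f φ x₀ t
    let q := rightEdge f φ x₀ t
    let J := IsDownJump fun x => sol f φ x t
    let C := ContinuousAt fun x => sol f φ x t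
    match w with
    | .S => p = q ∧ J p
    | .char => p = q ∧ C p
    | .R => p < q ∧ C p ∧ C q
    | .SR => p < q ∧ J p ∧ C q
    | .RS => p < q ∧ C p ∧ J q
    | .SRS => p < q ∧ J p ∧ J q
  have key : ∀ w, Emits f φ x₀ w → ∃ T > 0, ∀ t ∈ Ioo 0 T, P w t := by
    intro w hw
    have hC : ∀ {T X}, CharAlong f φ x₀ T X → ∀ t ∈ Ioo 0 T,
        ContinuousAt (fun x => sol f φ x t) (X t) := fun ⟨c, hc⟩ t ht => (hc t ht).2.2
    cases w with
    | S =>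
      obtain ⟨T, p, hW, hp⟩ := hw
      refine ⟨T, hW.pos, fun t ht => ?_⟩
      obtain ⟨e₁, e₂⟩ := h.edges_eq hW ht
      exact ⟨e₁ ▸ e₂, e₁ ▸ hp t ht⟩
    | char =>
      obtain ⟨T, p, hW, hp⟩ := hw
      refine ⟨T, hW.pos, fun t ht => ?_⟩
      obtain ⟨e₁, e₂⟩ := h.edges_eq hW ht
      exact ⟨e₁ ▸ e₂, e₁ ▸ hC hp t ht⟩
    | R =>
      obtain ⟨T, p, q, hW, hlt, hp, hq⟩ := hw
      refine ⟨T, hW.pos, fun t ht => ?_⟩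
      obtain ⟨e₁, e₂⟩ := h.edges_eq hW ht
      exact ⟨e₁ ▸ e₂ ▸ hlt t ht, e₁ ▸ hC hp t ht, e₂ ▸ hC hq t ht⟩
    | SR =>
      obtain ⟨T, p, q, hW, hlt, hp, hq⟩ := hw
      refine ⟨T, hW.pos, fun t ht => ?_⟩
      obtain ⟨e₁, e₂⟩ := h.edges_eq hW ht
      exact ⟨e₁ ▸ e₂ ▸ hlt t ht, e₁ ▸ hp t ht, e₂ ▸ hC hq t ht⟩
    | RS =>
      obtain ⟨T, p, q, hW, hlt, hp, hq⟩ := hw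
      refine ⟨T, hW.pos, fun t ht => ?_⟩
      obtain ⟨e₁, e₂⟩ := h.edges_eq hW ht
      exact ⟨e₁ ▸ e₂ ▸ hlt t ht, e₁ ▸ hC hp t ht, e₂ ▸ hq t ht⟩
    | SRS =>
      obtain ⟨T, p, q, hW, hlt, hp, hq⟩ := hw
      refine ⟨T, hW.pos, fun t ht => ?_⟩
      obtain ⟨e₁, e₂⟩ := h.edges_eq hW ht
      exact ⟨e₁ ▸ e₂ ▸ hlt t ht, e₁ ▸ hp t ht, e₂ ▸ hq t ht⟩
  obtain ⟨T, hT, hP⟩ := key w hw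
  obtain ⟨T', hT', hP'⟩ := key w' hw'
  obtain ⟨t, ht, ht'⟩ := exists_between (lt_min hT hT')
  have h1 := hP t ⟨ht, ht'.trans_le (min_le_left _ _)⟩
  have h2 := hP' t ⟨ht, ht'.trans_le (min_le_right _ _)⟩
  have hlt : ∀ {x y : ℝ}, x < y → x = y → False := fun h h' => h.ne h'
  have hJ : ∀ {x : ℝ}, IsDownJump (fun x => sol f φ x t) x →
      ContinuousAt (fun x => sol f φ x t) x → False := fun h => not_continuousAt_of_isDownJump h
  cases w <;> cases w' <;> first | rfl | (exfalso; simp only [P] at h1 h2; tauto)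

/-! ### The comparison of `Φ(l; x₀, c)` with `F(l; t, c)` -/

theorem eventually_deriv_uOf (h : Admissible f φ M) (c t : ℝ) :
    ∀ᶠ l in 𝓝 (0 : ℝ), deriv f (uOf f l t c) = deriv f c - l / t := by
  have hc : Tendsto (fun l : ℝ => deriv f c - l / t) (𝓝 0) (𝓝 (deriv f c)) := by
    have : Continuous fun l : ℝ => deriv f c - l / t := by fun_prop
    simpa using this.tendsto 0
  filter_upwards [hc (Icc_mem_nhds (h.strictMono (sub_one_lt c)) (h.strictMono (lt_add_one c)))]
    with l hl
  exact Function.invFun_eq (h.exists_deriv_eq hl.1 hl.2)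

theorem tendsto_uOf (h : Admissible f φ M) (c t : ℝ) :
    Tendsto (fun l => uOf f l t c) (𝓝 0) (𝓝 c) := by
  rw [h.isEmbedding_deriv.isInducing.tendsto_nhds_iff]
  have : Continuous fun l : ℝ => deriv f c - l / t := by fun_prop
  have h0 : Tendsto (fun l : ℝ => deriv f c - l / t) (𝓝 0) (𝓝 (deriv f c)) := by
    simpa using this.tendsto 0
  exact h0.congr' ((h.eventually_deriv_uOf c t).mono fun l hl => hl.symm)

theorem F_eq (h : Admissible f φ M) (l t c : ℝ) :
    F f l t c = -(t * (legendre f (uOf f l t c) - legendre f c -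
      c * (deriv f (uOf f l t c) - deriv f c))) := by
  rw [F, h.integral_sub_mul_deriv_deriv]

theorem F_nonpos (h : Admissible f φ M) {t : ℝ} (ht : 0 ≤ t) (l c : ℝ) : F f l t c ≤ 0 := by
  rw [h.F_eq, neg_nonpos]
  exact mul_nonneg ht (sub_nonneg.2 (h.legendre_le _ _))

/-- The comparison `F < Φ` measures the cost of competing with the value `c` on its
characteristic. -/
theorem excess_sub_F (h : Admissible f φ M) {x₀ l t c : ℝ} (ht : 0 < t)
    (hu : deriv f (uOf f l t c) = deriv f c - l / t) :
    excess φ l x₀ c - F f l t c = primitive φ (x₀ + l) - primitive φ x₀ +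
      t * (legendre f (uOf f l t c) - legendre f c) := by
  rw [h.excess_eq, h.F_eq, hu]
  field_simp
  ring

/-- The comparison `F < Φ` gets easier as `t` decreases. -/
theorem eventually_F_le (h : Admissible f φ M) {s t : ℝ} (hs : 0 < s) (hst : s ≤ t) (c : ℝ) :
    ∀ᶠ l in 𝓝 (0 : ℝ), F f l s c ≤ F f l t c := by
  have ht := hs.trans_le hst
  filter_upwards [h.eventually_deriv_uOf c s, h.eventually_deriv_uOf c t] with l h1 h2
  rw [h.F_eq, h.F_eq]
  set u := uOf f l s c
  set z := uOf f l t c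
  have e1 : s * deriv f u = s * deriv f c - l := by rw [h1]; field_simp
  have e2 : t * deriv f z = t * deriv f c - l := by rw [h2]; field_simp
  have i1 := mul_le_mul_of_nonneg_left (h.legendre_le z u) hs.le
  have i2 := mul_le_mul_of_nonneg_left (h.legendre_le z c) (sub_nonneg.2 hst)
  have i3 : z * (s * deriv f u + (t - s) * deriv f c - t * deriv f z) = 0 := by
    rw [e1, e2]; ring
  have i4 : c * (s * deriv f u + (t - s) * deriv f c - t * deriv f z) = 0 := by
    rw [e1, e2]; ring
  linarith

/-- In particular `F(l; t, c) ≥ -o(|l|)` as `l → 0`, because `u(l; t, c) → c`. -/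
theorem le_F (h : Admissible f φ M) {l t c : ℝ} (ht : 0 < t)
    (hu : deriv f (uOf f l t c) = deriv f c - l / t) : (uOf f l t c - c) * l ≤ F f l t c := by
  have := mul_le_mul_of_nonneg_left (h.legendre_le (uOf f l t c) c) ht.le
  rw [h.F_eq]
  have e : t * deriv f (uOf f l t c) = t * deriv f c - l := by rw [hu]; field_simp
  have e' : (uOf f l t c - c) * (t * deriv f (uOf f l t c) - (t * deriv f c - l)) = 0 := by
    rw [e]; ring
  linarith

/-- A comparison near `l = 0` suffices: competitors range over `[-M, M]`, so for small times all
their feet are close to `x₀`. -/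
theorem mem_charValues_iff (h : Admissible f φ M) {x₀ c : ℝ} :
    c ∈ charValues f φ x₀ ↔
      ∃ t > 0, ∀ᶠ l in 𝓝[≠] (0 : ℝ), F f l t c < excess φ l x₀ c := by
  constructor
  · intro hc
    obtain ⟨T, hT, hs⟩ := h.exists_singleton_of_mem hc
    obtain ⟨t, ht, htT⟩ := exists_between hT
    refine ⟨t, ht, ?_⟩
    filter_upwards [(h.eventually_deriv_uOf c t).filter_mono nhdsWithin_le_nhds,
      self_mem_nhdsWithin] with l hu hl
    rw [← sub_pos, h.excess_sub_F ht hu]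
    have hsing := hs t ⟨ht, htT⟩
    set u := uOf f l t c
    have hcm : c ∈ maximizers f φ (x₀ + t * deriv f c) t := hsing ▸ rfl
    have hum : u ∉ maximizers f φ (x₀ + t * deriv f c) t := by
      rw [hsing, mem_singleton_iff]
      intro he
      rw [he] at hu
      have : l / t = 0 := by linarith
      exact hl ((div_eq_zero_iff.1 this).resolve_right ht.ne')
    rw [h.mem_maximizers ht] at hcm hum
    push Not at hum
    obtain ⟨v, hv⟩ := hum
    have := (hcm v).trans_lt hv
    unfold cost at this
    rw [add_sub_cancel_right, hu,
      show x₀ + t * deriv f c - t * (deriv f c - l / t) = x₀ + l by field_simp; ring] at this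
    linarith
  · rintro ⟨t, ht, hF⟩
    rw [eventually_nhdsWithin_iff] at hF
    obtain ⟨δ, hδ, hb⟩ := Metric.eventually_nhds_iff.1 (hF.and (h.eventually_deriv_uOf c t))
    set K := |deriv f c - deriv f (-M)| + |deriv f c - deriv f M|
    have hK : 0 ≤ K := by positivity
    obtain ⟨s, hs, hs'⟩ := exists_between (lt_min ht (div_pos hδ (by linarith : 0 < K + 1)))
    have hst := hs'.le.trans (min_le_left _ _)
    have hsδ : s * (K + 1) < δ := (lt_div_iff₀ (by linarith)).1 (hs'.trans_le (min_le_right _ _))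
    refine ⟨s, hs, h.mem_maximizers_of_Icc hs fun v hv => ?_⟩
    rcases eq_or_ne v c with rfl | hne
    · exact le_rfl
    set l := s * (deriv f c - deriv f v)
    have hl0 : l ≠ 0 := mul_ne_zero hs.ne' (sub_ne_zero.2 fun he =>
      hne (h.strictMono.injective he).symm)
    have hlδ : |l| < δ := by
      have h1 := h.strictMono.monotone hv.1
      have h2 := h.strictMono.monotone hv.2
      have h3 : |deriv f c - deriv f v| ≤ K := by
        rw [abs_le]
        have a1 := neg_abs_le (deriv f c - deriv f M)
        have a2 := le_abs_self (deriv f c - deriv f (-M))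
        have a3 := abs_nonneg (deriv f c - deriv f M)
        have a4 := abs_nonneg (deriv f c - deriv f (-M))
        constructor <;> simp only [K] <;> linarith
      rw [abs_mul, abs_of_pos hs]
      have := mul_le_mul_of_nonneg_left h3 hs.le
      linarith
    obtain ⟨h1, hu⟩ := hb (y := l) (by simpa [Real.dist_eq] using hlδ)
    have h1 := h1 hl0
    rw [← sub_pos, h.excess_sub_F ht hu] at h1
    set z := uOf f l t c
    have e : t * deriv f z = t * deriv f c - l := by rw [hu]; field_simp
    -- `f'(z)` is a convex combination of `f'(v)` and `f'(c)`
    have i1 := mul_le_mul_of_nonneg_left (h.legendre_le z v) hs.le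
    have i2 := mul_le_mul_of_nonneg_left (h.legendre_le z c) (sub_nonneg.2 hst)
    have i3 : z * (s * deriv f v + (t - s) * deriv f c - t * deriv f z) = 0 := by
      rw [e]; simp only [l]; ring
    unfold cost
    rw [add_sub_cancel_right,
      show x₀ + s * deriv f c - s * deriv f v = x₀ + l by simp only [l]; ring]
    linarith

theorem mem_charValues_iff_sides (h : Admissible f φ M) {x₀ c : ℝ} :
    c ∈ charValues f φ x₀ ↔
      (∃ t > 0, ∀ᶠ l in 𝓝[<] (0 : ℝ), F f l t c < excess φ l x₀ c) ∧
      ∃ t > 0, ∀ᶠ l in 𝓝[>] (0 : ℝ), F f l t c < excess φ l x₀ c := by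
  rw [h.mem_charValues_iff]
  simp only [← Iio_union_Ioi, nhdsWithin_union, eventually_sup]
  constructor
  · rintro ⟨t, ht, h1, h2⟩
    exact ⟨⟨t, ht, h1⟩, t, ht, h2⟩
  · rintro ⟨⟨s, hs, h1⟩, t, ht, h2⟩
    have hm := lt_min hs ht
    refine ⟨min s t, hm, ?_, ?_⟩
    · filter_upwards [h1, (h.eventually_F_le hm (min_le_left s t) c).filter_mono
        nhdsWithin_le_nhds] with l h3 h4 using h4.trans_lt h3
    · filter_upwards [h2, (h.eventually_F_le hm (min_le_right s t) c).filter_mono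
        nhdsWithin_le_nhds] with l h3 h4 using h4.trans_lt h3

/-! ### Dini derivatives -/

theorem slope_primitive (φ : ℝ → ℝ) (x₀ l : ℝ) :
    slope (primitive φ) x₀ (x₀ + l) = (primitive φ (x₀ + l) - primitive φ x₀) / l := by
  rw [slope_def_field, add_sub_cancel_left]

theorem abs_slope_le (h : Admissible f φ M) (x₀ x : ℝ) : |slope (primitive φ) x₀ x| ≤ M := by
  rw [slope_def_field, abs_div]
  exact div_le_of_le_mul₀ (abs_nonneg _) h.nonneg (h.abs_primitive_sub_le x₀ x)

theorem isBounded_slope (h : Admissible f φ M) (x₀ : ℝ) (L : Filter ℝ) :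
    L.IsBoundedUnder (· ≤ ·) (slope (primitive φ) x₀) ∧
      L.IsBoundedUnder (· ≥ ·) (slope (primitive φ) x₀) :=
  ⟨isBoundedUnder_of ⟨M, fun x => (abs_le.1 (h.abs_slope_le x₀ x)).2⟩,
    isBoundedUnder_of ⟨-M, fun x => (abs_le.1 (h.abs_slope_le x₀ x)).1⟩⟩

theorem tendsto_add_right (x₀ : ℝ) : Tendsto (fun l => x₀ + l) (𝓝[>] 0) (𝓝[>] x₀) := by
  refine tendsto_nhdsWithin_iff.2 ⟨?_, ?_⟩
  · have : Continuous fun l : ℝ => x₀ + l := by fun_prop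
    simpa using (this.tendsto 0).mono_left nhdsWithin_le_nhds
  · filter_upwards [self_mem_nhdsWithin] with l hl
    exact lt_add_of_pos_right _ (mem_Ioi.1 hl)

theorem tendsto_add_left (x₀ : ℝ) : Tendsto (fun l => x₀ + l) (𝓝[<] 0) (𝓝[<] x₀) := by
  refine tendsto_nhdsWithin_iff.2 ⟨?_, ?_⟩
  · have : Continuous fun l : ℝ => x₀ + l := by fun_prop
    simpa using (this.tendsto 0).mono_left nhdsWithin_le_nhds
  · filter_upwards [self_mem_nhdsWithin] with l hl
    exact add_lt_of_neg_right _ (mem_Iio.1 hl)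

theorem tendsto_sub_right (x₀ : ℝ) : Tendsto (fun x => x - x₀) (𝓝[>] x₀) (𝓝[>] 0) := by
  refine tendsto_nhdsWithin_iff.2 ⟨?_, ?_⟩
  · have : Continuous fun l : ℝ => l - x₀ := by fun_prop
    simpa using (this.tendsto x₀).mono_left nhdsWithin_le_nhds
  · filter_upwards [self_mem_nhdsWithin] with l hl
    exact sub_pos.2 (mem_Ioi.1 hl)

theorem tendsto_sub_left (x₀ : ℝ) : Tendsto (fun x => x - x₀) (𝓝[<] x₀) (𝓝[<] 0) := by
  refine tendsto_nhdsWithin_iff.2 ⟨?_, ?_⟩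
  · have : Continuous fun l : ℝ => l - x₀ := by fun_prop
    simpa using (this.tendsto x₀).mono_left nhdsWithin_le_nhds
  · filter_upwards [self_mem_nhdsWithin] with l hl
    exact sub_neg.2 (mem_Iio.1 hl)

theorem right_of_lt (h : Admissible f φ M) {x₀ c t : ℝ} (ht : 0 < t)
    (hc : c < lowerRightDini (primitive φ) x₀) :
    ∀ᶠ l in 𝓝[>] (0 : ℝ), F f l t c < excess φ l x₀ c := by
  have h1 := eventually_lt_of_lt_liminf hc (h.isBounded_slope x₀ _).2
  filter_upwards [(tendsto_add_right x₀).eventually h1, self_mem_nhdsWithin] with l hl hpos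
  have hpos : 0 < l := hpos
  rw [slope_primitive, lt_div_iff₀ hpos] at hl
  refine (h.F_nonpos ht.le l c).trans_lt ?_
  rw [h.excess_eq]
  linarith

theorem left_of_lt (h : Admissible f φ M) {x₀ c t : ℝ} (ht : 0 < t)
    (hc : upperLeftDini (primitive φ) x₀ < c) :
    ∀ᶠ l in 𝓝[<] (0 : ℝ), F f l t c < excess φ l x₀ c := by
  have h1 := eventually_lt_of_limsup_lt hc (h.isBounded_slope x₀ _).1
  filter_upwards [(tendsto_add_left x₀).eventually h1, self_mem_nhdsWithin] with l hl hneg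
  have hneg : l < 0 := hneg
  rw [slope_primitive, div_lt_iff_of_neg hneg] at hl
  refine (h.F_nonpos ht.le l c).trans_lt ?_
  rw [h.excess_eq]
  linarith

theorem le_of_right (h : Admissible f φ M) {x₀ c t : ℝ} (ht : 0 < t)
    (hF : ∀ᶠ l in 𝓝[>] (0 : ℝ), F f l t c < excess φ l x₀ c) :
    c ≤ lowerRightDini (primitive φ) x₀ := by
  refine le_of_forall_lt fun d hd => ?_
  obtain ⟨e, hde, hec⟩ := exists_between hd
  refine hde.trans_le (le_liminf_of_le (h.isBounded_slope x₀ _).1.isCoboundedUnder_ge ?_)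
  have hev : ∀ᶠ l in 𝓝[>] (0 : ℝ), e ≤ slope (primitive φ) x₀ (x₀ + l) := by
    filter_upwards [hF, (h.eventually_deriv_uOf c t).filter_mono nhdsWithin_le_nhds,
      ((h.tendsto_uOf c t).eventually (lt_mem_nhds hec)).filter_mono nhdsWithin_le_nhds,
      self_mem_nhdsWithin] with l h1 h2 h3 hpos
    have hpos : 0 < l := hpos
    have h4 := (h.le_F ht h2).trans_lt h1
    rw [h.excess_eq] at h4
    rw [slope_primitive, le_div_iff₀ hpos]
    nlinarith
  exact ((tendsto_sub_right x₀).eventually hev).mono fun x hx => by simpa using hx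

theorem le_of_left (h : Admissible f φ M) {x₀ c t : ℝ} (ht : 0 < t)
    (hF : ∀ᶠ l in 𝓝[<] (0 : ℝ), F f l t c < excess φ l x₀ c) :
    upperLeftDini (primitive φ) x₀ ≤ c := by
  refine le_of_forall_gt fun d hd => ?_
  obtain ⟨e, hce, hed⟩ := exists_between hd
  refine (limsup_le_of_le (h.isBounded_slope x₀ _).2.isCoboundedUnder_le ?_).trans_lt hed
  have hev : ∀ᶠ l in 𝓝[<] (0 : ℝ), slope (primitive φ) x₀ (x₀ + l) ≤ e := by
    filter_upwards [hF, (h.eventually_deriv_uOf c t).filter_mono nhdsWithin_le_nhds,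
      ((h.tendsto_uOf c t).eventually (gt_mem_nhds hce)).filter_mono nhdsWithin_le_nhds,
      self_mem_nhdsWithin] with l h1 h2 h3 hneg
    have hneg : l < 0 := hneg
    have h4 := (h.le_F ht h2).trans_lt h1
    rw [h.excess_eq] at h4
    rw [slope_primitive, div_le_iff_of_neg hneg]
    nlinarith
  exact ((tendsto_sub_left x₀).eventually hev).mono fun x hx => by simpa using hx

theorem charValues_subset (h : Admissible f φ M) (x₀ : ℝ) :
    charValues f φ x₀ ⊆
      Icc (upperLeftDini (primitive φ) x₀) (lowerRightDini (primitive φ) x₀) := by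
  intro c hc
  obtain ⟨⟨s, hs, h1⟩, t, ht, h2⟩ := h.mem_charValues_iff_sides.1 hc
  exact ⟨h.le_of_left hs h1, h.le_of_right ht h2⟩

theorem Ioo_subset_charValues (h : Admissible f φ M) (x₀ : ℝ) :
    Ioo (upperLeftDini (primitive φ) x₀) (lowerRightDini (primitive φ) x₀) ⊆
      charValues f φ x₀ := fun _ hc =>
  h.mem_charValues_iff_sides.2 ⟨⟨1, one_pos, h.left_of_lt one_pos hc.1⟩,
    1, one_pos, h.right_of_lt one_pos hc.2⟩

/-! ### The type of the emitted wave -/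

theorem emits_S (h : Admissible f φ M) {x₀ : ℝ} (hC : charValues f φ x₀ = ∅) :
    Emits f φ x₀ .S :=
  ⟨1, leftEdge f φ x₀, h.waveBetween_self one_pos fun _ ht =>
    h.leftEdge_eq_rightEdge_of_subsingleton ht.1 (by simp [hC]), fun _ ht =>
    h.isDownJump_leftEdge ht.1 (by simp [hC])⟩

theorem emits_char (h : Admissible f φ M) {x₀ c : ℝ} (hC : charValues f φ x₀ = {c}) :
    Emits f φ x₀ .char := by
  obtain ⟨T, hT, hchar⟩ := h.exists_charAlong_leftEdge (c := c) (x₀ := x₀)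
    (by rw [hC]; exact isLeast_singleton)
  exact ⟨T, leftEdge f φ x₀, h.waveBetween_self hT fun _ ht =>
    h.leftEdge_eq_rightEdge_of_subsingleton ht.1 (by simp [hC]), hchar T le_rfl⟩

theorem emits_of_lt (h : Admissible f φ M) {x₀ a b : ℝ} (hab : a < b)
    (h1 : Ioo a b ⊆ charValues f φ x₀) (h2 : charValues f φ x₀ ⊆ Icc a b) :
    (charValues f φ x₀ = Icc a b ∧ Emits f φ x₀ .R) ∨
    (charValues f φ x₀ = Ioc a b ∧ Emits f φ x₀ .SR) ∨
    (charValues f φ x₀ = Ico a b ∧ Emits f φ x₀ .RS) ∨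
    (charValues f φ x₀ = Ioo a b ∧ Emits f φ x₀ .SRS) := by
  obtain ⟨d, hd, hd'⟩ := exists_between hab
  obtain ⟨c, hc, hc'⟩ := exists_between hd
  obtain ⟨T, hT, hlt⟩ := h.exists_leftEdge_lt_rightEdge (h1 ⟨hc, hc'.trans hd'⟩)
    (h1 ⟨hd, hd'⟩) hc'
  have hleft : a ∉ charValues f φ x₀ → ∀ T, ShockAlong f φ T (leftEdge f φ x₀) := by
    intro ha T t ht
    refine h.isDownJump_leftEdge ht.1 fun u hu => ?_
    have hau := lt_of_le_of_ne (h2 hu).1 fun he => ha (he ▸ hu)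
    obtain ⟨v, hv, hv'⟩ := exists_between hau
    exact ⟨v, h1 ⟨hv, hv'.trans_le (h2 hu).2⟩, hv'⟩
  have hright : b ∉ charValues f φ x₀ → ∀ T, ShockAlong f φ T (rightEdge f φ x₀) := by
    intro hb T t ht
    refine h.isDownJump_rightEdge ht.1 fun u hu => ?_
    have hub := lt_of_le_of_ne (h2 hu).2 fun he => hb (he ▸ hu)
    obtain ⟨v, hv, hv'⟩ := exists_between hub
    exact ⟨v, h1 ⟨(h2 hu).1.trans_lt hv, hv'⟩, hv⟩
  have hwave : ∀ T' > 0, T' ≤ T →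
      WaveBetween f φ x₀ T' (leftEdge f φ x₀) (rightEdge f φ x₀) ∧
      ∀ t ∈ Ioo 0 T', leftEdge f φ x₀ t < rightEdge f φ x₀ t := fun T' hT' hle => by
    have hlt' : ∀ t ∈ Ioo 0 T', leftEdge f φ x₀ t < rightEdge f φ x₀ t :=
      fun t ht => hlt t ⟨ht.1, ht.2.trans_le hle⟩
    exact ⟨h.waveBetween hT' (Or.inr hlt'), hlt'⟩
  have hset : ∀ u, u ∈ charValues f φ x₀ ↔
      (u = a ∧ a ∈ charValues f φ x₀) ∨ (u = b ∧ b ∈ charValues f φ x₀) ∨ u ∈ Ioo a b := by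
    intro u
    constructor
    · intro hu
      rcases (h2 hu).1.eq_or_lt with rfl | hau
      · exact Or.inl ⟨rfl, hu⟩
      rcases (h2 hu).2.eq_or_lt with rfl | hub
      · exact Or.inr (Or.inl ⟨rfl, hu⟩)
      · exact Or.inr (Or.inr ⟨hau, hub⟩)
    · rintro (⟨rfl, hu⟩ | ⟨rfl, hu⟩ | hu)
      exacts [hu, hu, h1 hu]
  by_cases ha : a ∈ charValues f φ x₀ <;> by_cases hb : b ∈ charValues f φ x₀
  · obtain ⟨T₁, hT₁, hc₁⟩ := h.exists_charAlong_leftEdge (x₀ := x₀) ⟨ha, fun u hu => (h2 hu).1⟩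
    obtain ⟨T₂, hT₂, hc₂⟩ := h.exists_charAlong_rightEdge (x₀ := x₀) ⟨hb, fun u hu => (h2 hu).2⟩
    obtain ⟨hW, hlt'⟩ := hwave (min T (min T₁ T₂)) (lt_min hT (lt_min hT₁ hT₂)) (min_le_left _ _)
    refine Or.inl ⟨?_, _, _, _, hW, hlt', hc₁ _ ?_, hc₂ _ ?_⟩
    · ext u
      rw [hset]
      simp only [ha, hb, mem_Icc, mem_Ioo]
      grind
    · exact (min_le_right _ _).trans (min_le_left _ _)
    · exact (min_le_right _ _).trans (min_le_right _ _)
  · obtain ⟨T₁, hT₁, hc₁⟩ := h.exists_charAlong_leftEdge (x₀ := x₀) ⟨ha, fun u hu => (h2 hu).1⟩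
    obtain ⟨hW, hlt'⟩ := hwave (min T T₁) (lt_min hT hT₁) (min_le_left _ _)
    refine Or.inr (Or.inr (Or.inl ⟨?_, _, _, _, hW, hlt', hc₁ _ (min_le_right _ _), hright hb _⟩))
    ext u
    rw [hset]
    simp only [ha, hb, mem_Ico, mem_Ioo]
    grind
  · obtain ⟨T₂, hT₂, hc₂⟩ := h.exists_charAlong_rightEdge (x₀ := x₀) ⟨hb, fun u hu => (h2 hu).2⟩
    obtain ⟨hW, hlt'⟩ := hwave (min T T₂) (lt_min hT hT₂) (min_le_left _ _)
    refine Or.inr (Or.inl ⟨?_, _, _, _, hW, hlt', hleft ha _, hc₂ _ (min_le_right _ _)⟩)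
    ext u
    rw [hset]
    simp only [ha, hb, mem_Ioc, mem_Ioo]
    grind
  · obtain ⟨hW, hlt'⟩ := hwave T hT le_rfl
    refine Or.inr (Or.inr (Or.inr ⟨?_, _, _, _, hW, hlt', hleft ha _, hright hb _⟩))
    ext u
    rw [hset]
    simp only [ha, hb, mem_Ioo]
    grind

end Admissible

/-! ### Power asymptotics -/

/-- Pointwise almost everywhere bounds by powers integrate to bounds by powers. -/
theorem integral_rpow_bounds {h : ℝ → ℝ} {β A B δ : ℝ} (hβ : 0 ≤ β)
    (hint : ∀ r, IntervalIntegrable h volume 0 r)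
    (hb : ∀ᵐ s, s ∈ Ioo 0 δ → A * s ^ β ≤ h s ∧ h s ≤ B * s ^ β) {r : ℝ} (hr : r ∈ Ioo 0 δ) :
    A / (β + 1) * r ^ (β + 1) ≤ ∫ s in 0..r, h s ∧
      ∫ s in 0..r, h s ≤ B / (β + 1) * r ^ (β + 1) := by
  have hpow : ∀ K, IntervalIntegrable (fun s : ℝ => K * s ^ β) volume 0 r := fun K =>
    (intervalIntegral.intervalIntegrable_rpow' (by linarith)).const_mul K
  have hval : ∀ K : ℝ, ∫ s in 0..r, K * s ^ β = K / (β + 1) * r ^ (β + 1) := fun K => by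
    rw [intervalIntegral.integral_const_mul, integral_rpow (Or.inl (by linarith)),
      Real.zero_rpow (by linarith)]
    ring
  have hae : ∀ᵐ s ∂volume.restrict (Icc 0 r), A * s ^ β ≤ h s ∧ h s ≤ B * s ^ β := by
    rw [← restrict_Ioo_eq_restrict_Icc, ae_restrict_iff' measurableSet_Ioo]
    filter_upwards [hb] with s hs hs' using hs ⟨hs'.1, hs'.2.trans hr.2⟩
  rw [← hval, ← hval]
  exact ⟨intervalIntegral.integral_mono_ae_restrict hr.1.le (hpow A) (hint r)
      (hae.mono fun s hs => hs.1),
    intervalIntegral.integral_mono_ae_restrict hr.1.le (hint r) (hpow B)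
      (hae.mono fun s hs => hs.2)⟩

theorem lowerRate_map (φ : ℝ → ℝ) (x₀ c α τ : ℝ) (L : Filter ℝ) :
    lowerRate φ x₀ c (map (fun s => τ * s) L) α = liminf (fun ρ =>
      ((|τ * ρ| ^ (-((2 + α) / (1 + α))) * excess φ (τ * ρ) x₀ c : ℝ) : EReal)) L := by
  simp only [lowerRate, liminf, map_map, Function.comp_def]

namespace Admissible

variable {f φ : ℝ → ℝ} {M : ℝ}

/-- Integrated form of `f''(u) ∼ N |u - c|^α`, on the side `u = c - τ r`, `r > 0`, where `τ = ±1`: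
bounds for `f'(c) - f'(u)` and for `∫_c^u (s - c) f''(s) ds`. -/
theorem flux_bounds (h : Admissible f φ M) {c α N τ : ℝ} {L : Filter ℝ} (hτ : τ * τ = 1)
    (hL : Tendsto (fun s => c - τ * s) (𝓝[>] 0) L) (hA : FluxAsymp f c L α N) :
    ∃ A₁ > 0, ∃ B₁ > 0, ∃ A₂ > 0, ∃ B₂ > 0, ∀ᶠ r in 𝓝[>] (0 : ℝ),
      (A₁ * r ^ (α + 1) ≤ τ * (deriv f c - deriv f (c - τ * r)) ∧
        τ * (deriv f c - deriv f (c - τ * r)) ≤ B₁ * r ^ (α + 1)) ∧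
      A₂ * r ^ (α + 2) ≤ legendre f (c - τ * r) - legendre f c -
          c * (deriv f (c - τ * r) - deriv f c) ∧
        legendre f (c - τ * r) - legendre f c - c * (deriv f (c - τ * r) - deriv f c) ≤
          B₂ * r ^ (α + 2) := by
  obtain ⟨hα, hN, hlim⟩ := hA
  have habs : |τ| = 1 := by
    have : |τ| * |τ| = 1 := by rw [← abs_mul, hτ, abs_one]
    nlinarith [abs_nonneg τ]
  have hev : ∀ᶠ s in 𝓝[>] (0 : ℝ), N / 2 * s ^ α ≤ deriv (deriv f) (c - τ * s) ∧
      deriv (deriv f) (c - τ * s) ≤ 2 * N * s ^ α := by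
    filter_upwards [(hlim.comp hL).eventually (Ioo_mem_nhds (half_lt_self hN)
      (by linarith : N < 2 * N)), self_mem_nhdsWithin] with s hs hpos
    have hpos : 0 < s := hpos
    simp only [Function.comp_apply, sub_sub_cancel_left, abs_neg, abs_mul, habs, one_mul,
      abs_of_pos hpos] at hs
    have hp := Real.rpow_pos_of_pos hpos α
    exact ⟨((lt_div_iff₀ hp).1 hs.1).le, ((div_lt_iff₀ hp).1 hs.2).le⟩
  obtain ⟨δ, hδ, hδb⟩ := mem_nhdsGT_iff_exists_Ioo_subset.1 hev
  have hcont := h.continuous_deriv_deriv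
  have hlin : ∀ s, HasDerivAt (fun s => c - τ * s) (-τ) s := fun s => by
    simpa using ((hasDerivAt_id s).const_mul τ).const_sub c
  have i₁ : ∀ r, IntervalIntegrable (fun s => deriv (deriv f) (c - τ * s)) volume 0 r := fun r =>
    Continuous.intervalIntegrable (by fun_prop) _ _
  have i₂ : ∀ r, IntervalIntegrable (fun s => s * deriv (deriv f) (c - τ * s)) volume 0 r :=
    fun r => Continuous.intervalIntegrable (by fun_prop) _ _
  have e₁ : ∀ r, ∫ s in (0 : ℝ)..r, deriv (deriv f) (c - τ * s) =
      τ * (deriv f c - deriv f (c - τ * r)) := fun r => by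
    have hd : ∀ s ∈ uIcc 0 r, HasDerivAt (fun s => -τ * deriv f (c - τ * s))
        (deriv (deriv f) (c - τ * s)) s := fun s _ =>
      (((h.hasDerivAt_deriv _).comp s (hlin s)).const_mul (-τ)).congr_deriv (by
        linear_combination (deriv (deriv f) (c - τ * s)) * hτ)
    rw [intervalIntegral.integral_eq_sub_of_hasDerivAt hd (i₁ r)]
    simp only [mul_zero, sub_zero]
    ring
  have e₂ : ∀ r, ∫ s in (0 : ℝ)..r, s * deriv (deriv f) (c - τ * s) =
      legendre f (c - τ * r) - legendre f c - c * (deriv f (c - τ * r) - deriv f c) := fun r => by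
    have hd : ∀ s ∈ uIcc 0 r, HasDerivAt
        (fun s => legendre f (c - τ * s) - c * deriv f (c - τ * s))
        (s * deriv (deriv f) (c - τ * s)) s := fun s _ =>
      (((h.hasDerivAt_legendre _).comp s (hlin s)).sub
        (((h.hasDerivAt_deriv _).comp s (hlin s)).const_mul c)).congr_deriv (by
        linear_combination (s * deriv (deriv f) (c - τ * s)) * hτ)
    rw [intervalIntegral.integral_eq_sub_of_hasDerivAt hd (i₂ r)]
    simp only [mul_zero, sub_zero]
    ring
  refine ⟨N / 2 / (α + 1), by positivity, 2 * N / (α + 1), by positivity,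
    N / 2 / (α + 1 + 1), by positivity, 2 * N / (α + 1 + 1), by positivity, ?_⟩
  filter_upwards [Ioo_mem_nhdsGT hδ] with r hr
  have b₁ := integral_rpow_bounds hα i₁ (ae_of_all _ fun s hs => hδb hs) hr
  have b₂ := integral_rpow_bounds (h := fun s => s * deriv (deriv f) (c - τ * s)) (A := N / 2)
    (B := 2 * N) (β := α + 1) (by linarith) i₂ (ae_of_all _ fun s hs => by
      have hs' := hδb hs
      have hs0 := hs.1.le
      rw [Real.rpow_add_one hs.1.ne']
      exact ⟨by linarith [mul_le_mul_of_nonneg_left hs'.1 hs0],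
        by linarith [mul_le_mul_of_nonneg_left hs'.2 hs0]⟩) hr
  rw [e₁] at b₁
  rw [e₂, show α + 1 + 1 = α + 2 by ring] at b₂
  rw [show α + 1 + 1 = α + 2 by ring]
  exact ⟨b₁, b₂⟩

/-- Under the power asymptotics of `f''`, `-F(l; t, c)` is comparable to
`t^{1-p} |l|^p` with `p = (2 + α)/(1 + α)`, uniformly in `t`. -/
theorem F_bounds (h : Admissible f φ M) {c α N τ : ℝ} {L : Filter ℝ} (hτ : τ * τ = 1)
    (hL : Tendsto (fun s => c - τ * s) (𝓝[>] 0) L) (hA : FluxAsymp f c L α N) :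
    ∃ k₁ > 0, ∃ k₂ > 0, ∀ t > 0, ∀ᶠ ρ in 𝓝[>] (0 : ℝ),
      k₁ * (t * (ρ / t) ^ ((2 + α) / (1 + α))) ≤ -F f (τ * ρ) t c ∧
        -F f (τ * ρ) t c ≤ k₂ * (t * (ρ / t) ^ ((2 + α) / (1 + α))) := by
  obtain ⟨A₁, hA₁, B₁, hB₁, A₂, hA₂, B₂, hB₂, hev⟩ := h.flux_bounds hτ hL hA
  have hα : 0 ≤ α := hA.1
  set p := (2 + α) / (1 + α) with hp
  have hp0 : 0 < p := by positivity
  refine ⟨A₂ * (B₁⁻¹) ^ p, by positivity, B₂ * (A₁⁻¹) ^ p, by positivity, fun t ht => ?_⟩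
  have hl : Tendsto (fun ρ : ℝ => τ * ρ) (𝓝[>] 0) (𝓝 0) := by
    have : Continuous fun ρ : ℝ => τ * ρ := by fun_prop
    simpa using (this.tendsto 0).mono_left nhdsWithin_le_nhds
  have hspec := hl.eventually (h.eventually_deriv_uOf c t)
  have hr : Tendsto (fun ρ => τ * (c - uOf f (τ * ρ) t c)) (𝓝[>] 0) (𝓝[>] 0) := by
    refine tendsto_nhdsWithin_iff.2 ⟨?_, ?_⟩
    · simpa using (((h.tendsto_uOf c t).comp hl).const_sub c).const_mul τ
    · filter_upwards [hspec, self_mem_nhdsWithin] with ρ h1 hρ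
      have hρ : 0 < ρ / t := div_pos hρ ht
      have h2 : deriv f c - deriv f (uOf f (τ * ρ) t c) = τ * (ρ / t) := by rw [h1]; ring
      rw [mem_Ioi]
      rcases lt_trichotomy τ 0 with h0 | h0 | h0
      · refine mul_pos_of_neg_of_neg h0 (sub_neg.2 (h.strictMono.lt_iff_lt.1 ?_))
        nlinarith
      · simp [h0] at hτ
      · refine mul_pos h0 (sub_pos.2 (h.strictMono.lt_iff_lt.1 ?_))
        nlinarith
  filter_upwards [hr.eventually hev, hr.eventually self_mem_nhdsWithin, hspec,
    self_mem_nhdsWithin] with ρ hb hr0 h1 hρ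
  have hρ : 0 < ρ / t := div_pos hρ ht
  set u := uOf f (τ * ρ) t c
  have hu : c - τ * (τ * (c - u)) = u := by linear_combination (u - c) * hτ
  rw [hu, h1] at hb
  set r := τ * (c - u)
  have hr0 : 0 < r := hr0
  have h3 : τ * (deriv f c - (deriv f c - τ * ρ / t)) = ρ / t := by
    linear_combination (ρ / t) * hτ
  rw [h3] at hb
  obtain ⟨⟨a1, b1⟩, a2, b2⟩ := hb
  have hpow : r ^ (α + 2) = (r ^ (α + 1)) ^ p := by
    rw [← Real.rpow_mul hr0.le, hp]
    congr 1
    field_simp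
    ring
  have hrp := Real.rpow_pos_of_pos hr0 (α + 1)
  have up : r ^ (α + 2) ≤ (A₁⁻¹) ^ p * (ρ / t) ^ p := by
    rw [hpow, ← Real.mul_rpow (by positivity) hρ.le]
    refine Real.rpow_le_rpow hrp.le ?_ hp0.le
    rw [← div_eq_inv_mul, le_div_iff₀ hA₁]
    linarith
  have lo : (B₁⁻¹) ^ p * (ρ / t) ^ p ≤ r ^ (α + 2) := by
    rw [hpow, ← Real.mul_rpow (by positivity) hρ.le]
    refine Real.rpow_le_rpow (by positivity) ?_ hp0.le
    rw [← div_eq_inv_mul, div_le_iff₀ hB₁]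
    linarith
  rw [h.F_eq, neg_neg, h1]
  have l1 := mul_le_mul_of_nonneg_left (a2.trans' (mul_le_mul_of_nonneg_left lo hA₂.le)) ht.le
  have l2 := mul_le_mul_of_nonneg_left (b2.trans (mul_le_mul_of_nonneg_left up hB₂.le)) ht.le
  constructor <;> linarith

/-- With power asymptotics of `f''`, the one-sided comparison holds for some `t` iff the rate is
not `-∞`. -/
theorem exists_side_iff_rate (h : Admissible f φ M) {x₀ c α N τ : ℝ} {L Lu : Filter ℝ}
    (hτ : τ * τ = 1) (hL : L = map (fun s => τ * s) (𝓝[>] 0))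
    (hLu : Tendsto (fun s => c - τ * s) (𝓝[>] 0) Lu) (hA : FluxAsymp f c Lu α N) :
    (∃ t > 0, ∀ᶠ l in L, F f l t c < excess φ l x₀ c) ↔ ⊥ < lowerRate φ x₀ c L α := by
  obtain ⟨k₁, hk₁, k₂, hk₂, hb⟩ := h.F_bounds hτ hLu hA
  have hα : 0 ≤ α := hA.1
  have habs : |τ| = 1 := by
    have : |τ| * |τ| = 1 := by rw [← abs_mul, hτ, abs_one]
    nlinarith [abs_nonneg τ]
  rw [hL, lowerRate_map]
  simp only [eventually_map]
  set p := (2 + α) / (1 + α) with hp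
  have hp1 : 1 < p := by
    rw [hp, lt_div_iff₀ (by linarith)]
    linarith
  have hscale : ∀ t : ℝ, 0 < t → ∀ ρ : ℝ, 0 < ρ → t * (ρ / t) ^ p = t ^ (1 - p) * ρ ^ p := by
    intro t ht ρ hρ
    rw [Real.div_rpow hρ.le ht.le, Real.rpow_sub ht, Real.rpow_one]
    field_simp
  have hnorm : ∀ ρ : ℝ, 0 < ρ → ∀ y : ℝ, |τ * ρ| ^ (-p) * y = y / ρ ^ p := fun ρ hρ y => by
    rw [abs_mul, habs, one_mul, abs_of_pos hρ, Real.rpow_neg hρ.le]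
    field_simp
  constructor
  · rintro ⟨t, ht, hF⟩
    refine (EReal.bot_lt_coe (-(k₂ * t ^ (1 - p)))).trans_le (le_liminf_of_le ?_ ?_)
    · isBoundedDefault
    filter_upwards [hF, hb t ht, self_mem_nhdsWithin] with ρ h1 h2 hρ
    have hρ : 0 < ρ := hρ
    rw [EReal.coe_le_coe_iff, hnorm ρ hρ, le_div_iff₀ (Real.rpow_pos_of_pos hρ p)]
    rw [hscale t ht ρ hρ] at h2
    linarith
  · intro hlt
    obtain ⟨m, -, hm⟩ := EReal.lt_iff_exists_real_btwn.1 hlt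
    -- `t` is chosen so that `k₁ t^{1-p} = |m| + 1`
    set t := ((|m| + 1) / k₁) ^ (1 - p)⁻¹ with ht_def
    have ht : 0 < t := by positivity
    have htp : k₁ * t ^ (1 - p) = |m| + 1 := by
      rw [ht_def, ← Real.rpow_mul (by positivity), inv_mul_cancel₀ (by linarith), Real.rpow_one]
      field_simp
    refine ⟨t, ht, ?_⟩
    have h1 := eventually_lt_of_lt_liminf hm
    filter_upwards [h1, hb t ht, self_mem_nhdsWithin] with ρ h1 h2 hρ
    have hρ : 0 < ρ := hρ
    have hρp := Real.rpow_pos_of_pos hρ p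
    rw [EReal.coe_lt_coe_iff, hnorm ρ hρ, lt_div_iff₀ hρp] at h1
    rw [hscale t ht ρ hρ, ← mul_assoc, htp] at h2
    have := mul_le_mul_of_nonneg_right (neg_abs_le m) hρp.le
    linarith

/-- Integrated form of `φ(x₀ + l) - c ∼ C sgn(l) |l|^γ`, for `l = τ r`, `r > 0`. -/
theorem excess_bounds (h : Admissible f φ M) {x₀ c γ C τ : ℝ} {L : Filter ℝ}
    (hτ : τ = 1 ∨ τ = -1) (hL : L = map (fun s => τ * s) (𝓝[>] 0))
    (hB : DataAsymp φ x₀ c L γ C) :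
    ∀ᶠ r in 𝓝[>] (0 : ℝ),
      (C - |C| / 2) / (γ + 1) * r ^ (γ + 1) ≤ excess φ (τ * r) x₀ c ∧
        excess φ (τ * r) x₀ c ≤ (C + |C| / 2) / (γ + 1) * r ^ (γ + 1) := by
  obtain ⟨hγ, hC, hlim⟩ := hB
  have hC' := abs_pos.2 hC
  have hττ : τ * τ = 1 := by rcases hτ with rfl | rfl <;> norm_num
  have hev := hlim.eventually (Ioo_mem_nhds (by linarith : C - |C| / 2 < C)
    (by linarith : C < C + |C| / 2))
  obtain ⟨U, hU, V, hV, hUV⟩ := eventually_inf.1 hev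
  rw [hL, mem_map] at hU
  obtain ⟨δ, hδ, hδU⟩ := mem_nhdsGT_iff_exists_Ioo_subset.1 hU
  have hae : ∀ᵐ s, τ * s ∈ V := by
    have hV' : ∀ᵐ l : ℝ, l ∈ V := hV
    rcases hτ with rfl | rfl
    · simpa using hV'
    · simpa using (Measure.measurePreserving_neg (volume : Measure ℝ)).quasiMeasurePreserving.ae hV'
  have hint : ∀ r, IntervalIntegrable (fun s => τ * (φ (x₀ + τ * s) - c)) volume 0 r := fun r => by
    have h1 := (h.intervalIntegrable (x₀ + τ * 0) (x₀ + τ * r)).comp_add_left x₀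
    have h2 := h1.comp_mul_left (c := τ)
    have h3 : τ ≠ 0 := by rintro rfl; simp at hττ
    simp only [add_sub_cancel_left, mul_div_cancel_left₀ _ h3] at h2
    exact (h2.sub intervalIntegrable_const).const_mul τ
  have hexc : ∀ r, ∫ s in (0 : ℝ)..r, τ * (φ (x₀ + τ * s) - c) = excess φ (τ * r) x₀ c := by
    intro r
    rw [intervalIntegral.integral_const_mul, excess]
    have := intervalIntegral.smul_integral_comp_add_mul (a := 0) (b := r) (fun ξ => φ ξ - c) τ x₀
    simpa using this
  filter_upwards [Ioo_mem_nhdsGT hδ] with r hr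
  rw [← hexc]
  refine integral_rpow_bounds (δ := δ) hγ.le hint ?_ hr
  filter_upwards [hae] with s hs hsδ
  have hq := hUV (τ * s) ⟨hδU hsδ, hs⟩
  have hs0 : 0 < s := hsδ.1
  have hsign : Real.sign (τ * s) * |τ * s| ^ γ = τ * s ^ γ := by
    rcases hτ with rfl | rfl
    · rw [one_mul, Real.sign_of_pos hs0, abs_of_pos hs0]
    · rw [Real.sign_of_neg (by linarith), neg_one_mul s, abs_neg, abs_of_pos hs0]
  have hsp := Real.rpow_pos_of_pos hs0 γ
  have hquot : (φ (x₀ + τ * s) - c) / (τ * s ^ γ) = τ * (φ (x₀ + τ * s) - c) / s ^ γ := by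
    rcases hτ with rfl | rfl
    · simp
    · rw [neg_one_mul (s ^ γ), neg_one_mul (φ _ - c), div_neg, neg_div]
  rw [hsign, hquot, lt_div_iff₀ hsp, div_lt_iff₀ hsp] at hq
  exact ⟨hq.1.le, hq.2.le⟩

/-- The rate compares the order `γ + 1` of `Φ` with the order `p = (2 + α)/(1 + α)` of `F`, and
`p ≤ γ + 1` means `1 ≤ γ (1 + α)`. -/
theorem rate_iff_of_data (h : Admissible f φ M) {x₀ c α γ C τ : ℝ} {L : Filter ℝ} (hα : 0 ≤ α)
    (hτ : τ = 1 ∨ τ = -1) (hL : L = map (fun s => τ * s) (𝓝[>] 0))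
    (hB : DataAsymp φ x₀ c L γ C) :
    ⊥ < lowerRate φ x₀ c L α ↔ 0 < C ∨ 1 ≤ γ * (1 + α) := by
  have hb := h.excess_bounds hτ hL hB
  obtain ⟨hγ, hC, -⟩ := hB
  rw [hL, lowerRate_map]
  set p := (2 + α) / (1 + α) with hp
  have hpγ : p ≤ γ + 1 ↔ 1 ≤ γ * (1 + α) := by
    rw [hp, div_le_iff₀ (by linarith)]
    constructor <;> intro h' <;> linarith
  have hnorm : ∀ ρ : ℝ, 0 < ρ → ∀ y : ℝ, |τ * ρ| ^ (-p) * y = y / ρ ^ p := fun ρ hρ y => by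
    have habs : |τ| = 1 := by rcases hτ with rfl | rfl <;> simp
    rw [abs_mul, habs, one_mul, abs_of_pos hρ, Real.rpow_neg hρ.le]
    field_simp
  constructor
  · contrapose!
    rintro ⟨hC0, hγα⟩
    have hneg : C < 0 := lt_of_le_of_ne hC0 hC
    have hlt : γ + 1 - p < 0 := by
      have := not_le.1 fun hle => hγα.not_ge (hpγ.1 hle)
      linarith
    have hco : (C + |C| / 2) / (γ + 1) < 0 := by
      rw [abs_of_neg hneg]
      exact div_neg_of_neg_of_pos (by linarith) (by linarith)
    have hpow : Tendsto (fun ρ : ℝ => (C + |C| / 2) / (γ + 1) * ρ ^ (γ + 1 - p)) (𝓝[>] 0) atBot :=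
      (tendsto_rpow_neg_nhdsGT_zero hlt).const_mul_atTop_of_neg hco
    have hbot : Tendsto (fun ρ : ℝ => |τ * ρ| ^ (-p) * excess φ (τ * ρ) x₀ c) (𝓝[>] 0) atBot := by
      refine tendsto_atBot_mono' _ ?_ hpow
      filter_upwards [hb, self_mem_nhdsWithin] with ρ h1 hρ
      have hρ : 0 < ρ := hρ
      rw [hnorm ρ hρ, Real.rpow_sub hρ, ← mul_div_assoc]
      exact div_le_div_of_nonneg_right h1.2 (Real.rpow_pos_of_pos hρ p).le
    rw [(EReal.tendsto_coe_nhds_bot_iff.2 hbot).liminf_eq]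
  · intro hor
    set K := |C - |C| / 2| / (γ + 1)
    have hK : 0 ≤ K := by positivity
    refine (EReal.bot_lt_coe (-K)).trans_le (le_liminf_of_le ?_ ?_)
    · isBoundedDefault
    filter_upwards [hb, Ioo_mem_nhdsGT one_pos] with ρ h1 hρ
    have hρp := Real.rpow_pos_of_pos hρ.1 p
    have hργ := Real.rpow_pos_of_pos hρ.1 (γ + 1)
    rw [EReal.coe_le_coe_iff, hnorm ρ hρ.1, le_div_iff₀ hρp]
    rcases hor with hpos | hle
    · have : 0 ≤ (C - |C| / 2) / (γ + 1) := by
        rw [abs_of_pos hpos]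
        exact div_nonneg (by linarith) (by linarith)
      nlinarith [mul_nonneg this hργ.le, mul_nonneg hK hρp.le]
    · have e1 : ρ ^ (γ + 1) ≤ ρ ^ p :=
        Real.rpow_le_rpow_of_exponent_ge hρ.1 hρ.2.le (hpγ.2 hle)
      have e2 : -K ≤ (C - |C| / 2) / (γ + 1) := by
        rw [neg_le_iff_add_nonneg, ← add_div]
        exact div_nonneg (by linarith [neg_abs_le (C - |C| / 2)]) (by linarith)
      have e3 := mul_le_mul_of_nonneg_right e2 hργ.le
      have e4 := mul_le_mul_of_nonneg_left e1 hK
      linarith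

end Admissible

/-! ### The one-sided criteria -/

theorem nhdsLT_zero_eq_map : 𝓝[<] (0 : ℝ) = map (fun s => -1 * s) (𝓝[>] 0) := by
  simp

theorem nhdsGT_zero_eq_map : 𝓝[>] (0 : ℝ) = map (fun s => 1 * s) (𝓝[>] 0) := by
  simp

namespace Admissible

variable {f φ : ℝ → ℝ} {M : ℝ}

theorem left_iff_rate (h : Admissible f φ M) {x₀ c α N : ℝ} (hA : FluxAsymp f c (𝓝[>] c) α N) :
    (∃ t > 0, ∀ᶠ l in 𝓝[<] (0 : ℝ), F f l t c < excess φ l x₀ c) ↔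
      ⊥ < lowerRate φ x₀ c (𝓝[<] 0) α :=
  h.exists_side_iff_rate (τ := -1) (by norm_num) nhdsLT_zero_eq_map
    (by simpa using tendsto_add_right c) hA

theorem right_iff_rate (h : Admissible f φ M) {x₀ c α N : ℝ} (hA : FluxAsymp f c (𝓝[<] c) α N) :
    (∃ t > 0, ∀ᶠ l in 𝓝[>] (0 : ℝ), F f l t c < excess φ l x₀ c) ↔
      ⊥ < lowerRate φ x₀ c (𝓝[>] 0) α := by
  refine h.exists_side_iff_rate (τ := 1) (by norm_num) nhdsGT_zero_eq_map ?_ hA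
  have := (tendsto_add_left c).comp (tendsto_neg_nhdsGT (a := (0 : ℝ)) |>.mono_right (by simp))
  simpa [Function.comp_def, sub_eq_add_neg] using this

theorem left_rate_iff (h : Admissible f φ M) {x₀ c α γ C : ℝ} (hα : 0 ≤ α)
    (hB : DataAsymp φ x₀ c (𝓝[<] 0) γ C) :
    ⊥ < lowerRate φ x₀ c (𝓝[<] 0) α ↔ 0 < C ∨ 1 ≤ γ * (1 + α) :=
  h.rate_iff_of_data hα (Or.inr rfl) nhdsLT_zero_eq_map hB

theorem right_rate_iff (h : Admissible f φ M) {x₀ c α γ C : ℝ} (hα : 0 ≤ α)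
    (hB : DataAsymp φ x₀ c (𝓝[>] 0) γ C) :
    ⊥ < lowerRate φ x₀ c (𝓝[>] 0) α ↔ 0 < C ∨ 1 ≤ γ * (1 + α) :=
  h.rate_iff_of_data hα (Or.inl rfl) nhdsGT_zero_eq_map hB

end Admissible

end ScalarLaw

open ScalarLaw
theorem theorem3p2 (f φ : ℝ → ℝ) (hf : ContDiff ℝ 2 f)
    (hconv : ∀ u, 0 ≤ deriv (deriv f) u)
    (hnull : volume {u : ℝ | deriv (deriv f) u = 0} = 0)
    (hφ : MemLp φ ⊤ volume) (x₀ a b : ℝ)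
    (ha : a = upperLeftDini (primitive φ) x₀)
    (hb : b = lowerRightDini (primitive φ) x₀) :
    -- Criteria for all the cases of the set of characteristic generation values
    (b < a → charValues f φ x₀ = ∅) ∧
    (a < b →
      Ioo a b ⊆ charValues f φ x₀ ∧ charValues f φ x₀ ⊆ Icc a b ∧
      (a ∈ charValues f φ x₀ ↔
        ∃ t₁ > 0, ∀ᶠ l in 𝓝[<] (0 : ℝ), F f l t₁ a < excess φ l x₀ a) ∧
      (b ∈ charValues f φ x₀ ↔
        ∃ t₂ > 0, ∀ᶠ l in 𝓝[>] (0 : ℝ), F f l t₂ b < excess φ l x₀ b) ∧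
      (∀ α N, FluxAsymp f a (𝓝[>] a) α N →
        (a ∈ charValues f φ x₀ ↔ ⊥ < lowerRate φ x₀ a (𝓝[<] 0) α) ∧
        ∀ γ C, DataAsymp φ x₀ a (𝓝[<] 0) γ C →
          (a ∈ charValues f φ x₀ ↔ 0 < C ∨ 1 ≤ γ * (1 + α))) ∧
      (∀ α N, FluxAsymp f b (𝓝[<] b) α N →
        (b ∈ charValues f φ x₀ ↔ ⊥ < lowerRate φ x₀ b (𝓝[>] 0) α) ∧
        ∀ γ C, DataAsymp φ x₀ b (𝓝[>] 0) γ C →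
          (b ∈ charValues f φ x₀ ↔ 0 < C ∨ 1 ≤ γ * (1 + α)))) ∧
    (a = b →
      (charValues f φ x₀ = {a} ∨ charValues f φ x₀ = ∅) ∧
      (a ∈ charValues f φ x₀ ↔
        ∃ t₁ > 0, ∀ᶠ l in 𝓝[≠] (0 : ℝ), F f l t₁ a < excess φ l x₀ a) ∧
      (∀ αp Np αm Nm, FluxAsymp f a (𝓝[>] a) αp Np → FluxAsymp f a (𝓝[<] a) αm Nm →
        (charValues f φ x₀ = ∅ ↔
          lowerRate φ x₀ a (𝓝[>] 0) αm = ⊥ ∨ lowerRate φ x₀ a (𝓝[<] 0) αp = ⊥) ∧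
        ∀ γp Cp γm Cm, DataAsymp φ x₀ a (𝓝[>] 0) γp Cp → DataAsymp φ x₀ a (𝓝[<] 0) γm Cm →
          (charValues f φ x₀ = ∅ ↔
            (Cp < 0 ∧ γp * (1 + αm) < 1) ∨ (Cm < 0 ∧ γm * (1 + αp) < 1)))) ∧
    -- Classification of the initial waves
    (∃! w : WaveType, Emits f φ x₀ w) ∧
    (Emits f φ x₀ .S ↔ b < a ∨ (a = b ∧ charValues f φ x₀ = ∅)) ∧
    (Emits f φ x₀ .char ↔ a = b ∧ charValues f φ x₀ ≠ ∅) ∧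
    (Emits f φ x₀ .R ↔ a < b ∧ charValues f φ x₀ = Icc a b) ∧
    (Emits f φ x₀ .SR ↔ a < b ∧ charValues f φ x₀ = Ioc a b) ∧
    (Emits f φ x₀ .RS ↔ a < b ∧ charValues f φ x₀ = Ico a b) ∧
    (Emits f φ x₀ .SRS ↔ a < b ∧ charValues f φ x₀ = Ioo a b) := by
  obtain ⟨M, h⟩ := admissible_of hf hconv hnull hφ
  have hsub : charValues f φ x₀ ⊆ Icc a b := by
    rw [ha, hb]
    exact h.charValues_subset x₀
  have hsup : Ioo a b ⊆ charValues f φ x₀ := by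
    rw [ha, hb]
    exact h.Ioo_subset_charValues x₀
  have hgt : b < a → charValues f φ x₀ = ∅ := fun hba =>
    subset_empty_iff.1 (hsub.trans (Icc_eq_empty hba.not_ge).subset)
  have heq : a = b → charValues f φ x₀ = {a} ∨ charValues f φ x₀ = ∅ := fun hab => by
    rw [← hab, Icc_self] at hsub
    exact (subset_singleton_iff_eq.1 hsub).symm
  have hempty : a = b → (charValues f φ x₀ = ∅ ↔ a ∉ charValues f φ x₀) := fun hab => by
    rcases heq hab with h1 | h1 <;> simp [h1]
  have hleft : a < b → (a ∈ charValues f φ x₀ ↔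
      ∃ t₁ > 0, ∀ᶠ l in 𝓝[<] (0 : ℝ), F f l t₁ a < excess φ l x₀ a) := fun hab => by
    rw [h.mem_charValues_iff_sides]
    exact and_iff_left ⟨1, one_pos, h.right_of_lt one_pos (hb ▸ hab)⟩
  have hright : a < b → (b ∈ charValues f φ x₀ ↔
      ∃ t₂ > 0, ∀ᶠ l in 𝓝[>] (0 : ℝ), F f l t₂ b < excess φ l x₀ b) := fun hab => by
    rw [h.mem_charValues_iff_sides]
    exact and_iff_right ⟨1, one_pos, h.left_of_lt one_pos (ha ▸ hab)⟩
  refine ⟨hgt, fun hab => ⟨hsup, hsub, hleft hab, hright hab, fun α N hA => ?_,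
    fun α N hA => ?_⟩, fun hab => ⟨heq hab, h.mem_charValues_iff, fun αp Np αm Nm hp hm => ?_⟩, ?_⟩
  · rw [hleft hab, h.left_iff_rate hA]
    exact ⟨Iff.rfl, fun γ C hB => h.left_rate_iff hA.1 hB⟩
  · rw [hright hab, h.right_iff_rate hA]
    exact ⟨Iff.rfl, fun γ C hB => h.right_rate_iff hA.1 hB⟩
  · rw [hempty hab, h.mem_charValues_iff_sides, h.left_iff_rate hp, h.right_iff_rate hm]
    refine ⟨by rw [bot_lt_iff_ne_bot, bot_lt_iff_ne_bot]; tauto, fun γp Cp γm Cm hBp hBm => ?_⟩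
    rw [h.left_rate_iff hp.1 hBm, h.right_rate_iff hm.1 hBp, not_and_or, or_comm, not_or, not_or,
      not_lt, not_lt, not_le, not_le]
    have n1 := hBp.2.1.le_iff_lt
    have n2 := hBm.2.1.le_iff_lt
    rw [n1, n2]
  -- each of the exhaustive cases emits a wave of its type, and the type of a wave is unique
  have huniq : ∀ {w}, Emits f φ x₀ w → ∀ w', Emits f φ x₀ w' ↔ w' = w := fun hw w' =>
    ⟨fun hw' => h.eq_of_emits hw' hw, fun he => he ▸ hw⟩
  have hex : ∀ {w}, Emits f φ x₀ w → ∃! w, Emits f φ x₀ w := fun {w} hw =>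
    ⟨w, hw, fun _ hw' => h.eq_of_emits hw' hw⟩
  rcases lt_trichotomy a b with hab | hab | hab
  · have hne₁ : Icc a b ≠ Ioc a b := fun he => by simpa using he.subset (left_mem_Icc.2 hab.le)
    have hne₂ : Icc a b ≠ Ico a b := fun he => by simpa using he.subset (right_mem_Icc.2 hab.le)
    have hne₃ : Icc a b ≠ Ioo a b := fun he => by simpa using he.subset (left_mem_Icc.2 hab.le)
    have hne₄ : Ioc a b ≠ Ico a b := fun he => by simpa using he.subset (right_mem_Ioc.2 hab)
    have hne₅ : Ioc a b ≠ Ioo a b := fun he => by simpa using he.subset (right_mem_Ioc.2 hab)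
    have hne₆ : Ico a b ≠ Ioo a b := fun he => by simpa using he.subset (left_mem_Ico.2 hab)
    rcases h.emits_of_lt hab hsup hsub with ⟨hC, hw⟩ | ⟨hC, hw⟩ | ⟨hC, hw⟩ | ⟨hC, hw⟩ <;>
      refine ⟨hex hw, ?_⟩ <;> rw [hC] <;>
      simp [huniq hw, hab, hab.ne, hab.not_gt, hne₁, hne₂, hne₃, hne₄, hne₅, hne₆, hne₁.symm,
        hne₂.symm, hne₃.symm, hne₄.symm, hne₅.symm, hne₆.symm]
  · rcases heq hab with hC | hC
    · have hw := h.emits_char hC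
      refine ⟨hex hw, ?_⟩
      simp [huniq hw, hC, hab]
    · have hw := h.emits_S hC
      refine ⟨hex hw, ?_⟩
      simp [huniq hw, hC, hab]
  · have hw := h.emits_S (hgt hab)
    refine ⟨hex hw, ?_⟩
    simp [huniq hw, hab, hab.ne', hab.not_gt]
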